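/- Let $A_1$ and $A_2$ be unital complex Banach algebras and let $Y$ be a unital Banach $A_1$-$A_2$-bimodule, that is, a Banach space with commuting unital left $A_1$- and right $A_2$-actions that are bounded bilinear maps. Let $$\mathcal U=\begin{bmatrix}A_1&Y\\0&A_2\end{bmatrix}$$ be the algebra of triangular matrices with matrix multiplication, normed by $$\Big\|\begin{bmatrix}r_1&y\\0&r_2\end{bmatrix}\Big\|=\sup\big\{\max\{\|r_1d_1\|+\|r_1z+y\,d_2\|,\ \|r_2d_2\|\}: d_1\in A_1,\ z\in Y,\ d_2\in A_2,\ \|d_1\|+\|z\|\le1,\ \|d_2\|\le1\big\}$$ (if $A_1,A_2$ have identities of norm one and the actions on $Y$ are contractive, this is $\sup\{\max\{\|r_1d_1\|+\|y\,d_2\|,\|r_2d_2\|\}:\|d_1\|\le1,\|d_2\|\le1\}=\max\{\|r_1\|+\|y\|,\|r_2\|\}$; in every case the topology is that of $A_1\times Y\times A_2$). Let $B$ be the closed subalgebra of $\mathcal U$ generated by the idempotents $e_{11}$ and $e_{22}$, the identities of the two diagonal corners. For a Banach algebra $A$, the dual $A^*$ is the Banach $A$-bimodule with $(a\cdot\varphi)(b)=\varphi(ba)$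 and $(\varphi\cdot a)(b)=\varphi(ab)$; $C^n(A,A^*)$ is the Banach space of bounded $n$-linear maps $A^n\to A^*$ (with $C^0(A,A^*)=A^*$), with coboundary $$(\delta^nf)(a_1,\dots,a_{n+1})=a_1\cdot f(a_2,\dots,a_{n+1})+\sum_{i=1}^n(-1)^if(\dots,a_ia_{i+1},\dots)+(-1)^{n+1}f(a_1,\dots,a_n)\cdot a_{n+1},$$ and $\mathcal H^n(A,A^*)=\ker\delta^n/\operatorname{im}\delta^{n-1}$ (with $\operatorname{im}\delta^{-1}=0$) carries the quotient seminorm. For $n\ge1$, $C^n_B(\mathcal U,\mathcal U^*)$ is the subspace of the $\rho\in C^n(\mathcal U,\mathcal U^*)$ such that, for all $s\in B$, $\rho(sa_1,a_2,\dots,a_n)=s\cdot\rho(a_1,\dots,a_n)$, $\rho(\dots,a_is,a_{i+1},\dots)=\rho(\dots,a_i,sa_{i+1},\dots)$ for $1\le i<n$, and $\rho(a_1,\dots,a_ns)=\rho(a_1,\dots,a_n)\cdot s$; $C^0_B(\mathcal U,\mathcal U^*)=\{x\in\mathcal U^*: s\cdot x=x\cdot s\text{ for all }s\in B\}$. A bounded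 homomorphism $\pi:A\to A'$ of Banach algebras induces $\pi^\#:C^n(A',A'^*)\to C^n(A,A^*)$, $(\pi^\#f)(a_1,\dots,a_n)=f(\pi a_1,\dots,\pi a_n)\circ\pi$, which commutes with $\delta$. Let $\pi_i:\mathcal U\to A_i$ be the canonical projections. Then for every $n\ge0$: (a) $(f_1,f_2)\mapsto\pi_1^\#f_1+\pi_2^\#f_2$ is a linear homeomorphism of $C^n(A_1,A_1^*)\oplus C^n(A_2,A_2^*)$ onto $C^n_B(\mathcal U,\mathcal U^*)$. Its inverse sends $\rho$ to the pair of its restrictions to the diagonal corners $A_1$ and $A_2$ of $\mathcal U$ (in all arguments, including that of the functional $\rho(a_1,\dots,a_n)$). (b) The map $\mathcal H^n(A_1,A_1^*)\oplus\mathcal H^n(A_2,A_2^*)\to\mathcal H^n(\mathcal U,\mathcal U^*)$ induced by $\pi_1$ and $\pi_2$ is a linear homeomorphism of seminormed spaces. -/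

import Mathlib

set_option linter.unusedSectionVars false

open scoped MulOpposite

noncomputable section

namespace BanachCohomology

/-! ## Cochains, the coboundary operator and the cohomology groups

Here `A` is a unital complex Banach algebra and `X` is an `A`-bimodule, with left action
`a • x` and right action `x · a` written `MulOpposite.op a • x`. -/

section Cohomology

variable (A : Type*) [NormedRing A] [NormedAlgebra ℂ A]
variable (X : Type*) [NormedAddCommGroup X] [NormedSpace ℂ X]

/-- `C^n(A, X)`: bounded `n`-linear maps `A × ⋯ × A → X`, with the operator norm.
For `n = 0` this is `X`, through `x ↦ (the constant with value x)`. -/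
abbrev Cochain (n : ℕ) : Type _ := ContinuousMultilinearMap ℂ (fun _ : Fin n => A) X

variable {A X}

/-- Changing one entry `a k` changes one entry of the tuple
`(a 0, …, a i * a (i + 1), …, a n)`, through a fixed additive and homogeneous map. -/
theorem contractNth_update {n : ℕ} (i : Fin n) (a : Fin (n + 1) → A) (k : Fin (n + 1)) :
    ∃ (l : Fin n) (φ : A →ₗ[ℂ] A) (b : Fin n → A), ∀ x : A,
      Fin.contractNth i.castSucc (· * ·) (Function.update a k x) =
        Function.update b l (φ x) := by
  rcases lt_trichotomy (k : ℕ) (i : ℕ) with h | h | h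
  · refine ⟨⟨k, by omega⟩, LinearMap.id, Fin.contractNth i.castSucc (· * ·) a, fun x => ?_⟩
    ext j
    simp only [Fin.contractNth, Function.update_apply, Fin.ext_iff, Fin.val_castSucc,
      Fin.val_succ, LinearMap.id_apply]
    grind
  · refine ⟨i, LinearMap.mulRight ℂ (a i.succ), Fin.contractNth i.castSucc (· * ·) a,
      fun x => ?_⟩
    ext j
    simp only [Fin.contractNth, Function.update_apply, Fin.ext_iff, Fin.val_castSucc,
      Fin.val_succ, LinearMap.mulRight_apply]
    grind
  · by_cases h' : (k : ℕ) = i + 1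
    · refine ⟨i, LinearMap.mulLeft ℂ (a i.castSucc), Fin.contractNth i.castSucc (· * ·) a,
        fun x => ?_⟩
      ext j
      simp only [Fin.contractNth, Function.update_apply, Fin.ext_iff, Fin.val_castSucc,
        Fin.val_succ, LinearMap.mulLeft_apply]
      grind
    · refine ⟨⟨k - 1, by omega⟩, LinearMap.id, Fin.contractNth i.castSucc (· * ·) a,
        fun x => ?_⟩
      ext j
      simp only [Fin.contractNth, Function.update_apply, Fin.ext_iff, Fin.val_castSucc,
        Fin.val_succ, LinearMap.id_apply]
      grind

/-- `(a 0, …, a n) ↦ f (a 0, …, a i * a (i + 1), …, a n)`. -/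
def contractTerm {n : ℕ} (f : Cochain A X n) (i : Fin n) : Cochain A X (n + 1) where
  toFun a := f (Fin.contractNth i.castSucc (· * ·) a)
  map_update_add' {inst} a k x y := by
    obtain rfl : inst = instDecidableEqFin (n + 1) := Subsingleton.elim _ _
    obtain ⟨l, φ, b, h⟩ := contractNth_update i a k
    simp only [h, map_add, ContinuousMultilinearMap.map_update_add]
  map_update_smul' {inst} a k c x := by
    obtain rfl : inst = instDecidableEqFin (n + 1) := Subsingleton.elim _ _
    obtain ⟨l, φ, b, h⟩ := contractNth_update i a k
    simp only [h, map_smul, ContinuousMultilinearMap.map_update_smul]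
  cont := by
    refine f.cont.comp (continuous_pi fun j => ?_)
    unfold Fin.contractNth
    split_ifs <;> fun_prop

section Bimodule

variable [Module A X] [IsScalarTower ℂ A X] [ContinuousSMul A X]
variable [Module Aᵐᵒᵖ X] [IsScalarTower ℂ Aᵐᵒᵖ X] [ContinuousSMul Aᵐᵒᵖ X]

/-- `(a 0, …, a n) ↦ a 0 · f (a 1, …, a n)`. -/
def leftTerm {n : ℕ} (f : Cochain A X n) : Cochain A X (n + 1) where
  toFun a := a 0 • f (Fin.tail a)
  map_update_add' {inst} a k x y := by
    obtain rfl : inst = instDecidableEqFin (n + 1) := Subsingleton.elim _ _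
    refine Fin.cases ?_ (fun k => ?_) k
    · simp [add_smul]
    · simp [Fin.tail_update_succ, Function.update_of_ne (Fin.succ_ne_zero k).symm]
  map_update_smul' {inst} a k c x := by
    obtain rfl : inst = instDecidableEqFin (n + 1) := Subsingleton.elim _ _
    refine Fin.cases ?_ (fun k => ?_) k
    · simp
    · have : SMulCommClass A ℂ X := IsScalarTower.to_smulCommClass'
      simp [Fin.tail_update_succ, Function.update_of_ne (Fin.succ_ne_zero k).symm, smul_comm _ c]
  cont := by
    refine (continuous_apply 0).smul (f.cont.comp (continuous_pi fun j => ?_))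
    exact continuous_apply j.succ

/-- `(a 0, …, a n) ↦ f (a 0, …, a (n - 1)) · a n`. -/
def rightTerm {n : ℕ} (f : Cochain A X n) : Cochain A X (n + 1) where
  toFun a := MulOpposite.op (a (Fin.last n)) • f (Fin.init a)
  map_update_add' {inst} a k x y := by
    obtain rfl : inst = instDecidableEqFin (n + 1) := Subsingleton.elim _ _
    refine Fin.lastCases ?_ (fun k => ?_) k
    · simp [add_smul]
    · simp [Fin.init_update_castSucc, (Fin.castSucc_lt_last k).ne']
  map_update_smul' {inst} a k c x := by
    obtain rfl : inst = instDecidableEqFin (n + 1) := Subsingleton.elim _ _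
    refine Fin.lastCases ?_ (fun k => ?_) k
    · simp
    · have : SMulCommClass Aᵐᵒᵖ ℂ X := IsScalarTower.to_smulCommClass'
      simp [Fin.init_update_castSucc, (Fin.castSucc_lt_last k).ne', smul_comm _ c]
  cont := by
    refine (MulOpposite.continuous_op.comp (continuous_apply (Fin.last n))).smul
      (f.cont.comp (continuous_pi fun j => ?_))
    exact continuous_apply j.castSucc

theorem contractTerm_apply {n : ℕ} (f : Cochain A X n) (i : Fin n) (a : Fin (n + 1) → A) :
    contractTerm f i a = f (Fin.contractNth i.castSucc (· * ·) a) := rfl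

theorem leftTerm_apply {n : ℕ} (f : Cochain A X n) (a : Fin (n + 1) → A) :
    leftTerm f a = a 0 • f (Fin.tail a) := rfl

theorem rightTerm_apply {n : ℕ} (f : Cochain A X n) (a : Fin (n + 1) → A) :
    rightTerm f a = MulOpposite.op (a (Fin.last n)) • f (Fin.init a) := rfl

variable (A X)

/-- The coboundary operator `δ^n : C^n(A, X) → C^{n+1}(A, X)`,
`(δ^n f)(a 0, …, a n) = a 0 · f(a 1, …, a n) + ∑_i (-1)^{i+1} f(…, a i * a (i+1), …)
  + (-1)^{n+1} f(a 0, …, a (n-1)) · a n`. -/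
def coboundary (n : ℕ) : Cochain A X n →ₗ[ℂ] Cochain A X (n + 1) where
  toFun f := leftTerm f + ∑ i : Fin n, (-1 : ℂ) ^ ((i : ℕ) + 1) • contractTerm f i
    + (-1 : ℂ) ^ (n + 1) • rightTerm f
  map_add' f g := by
    ext a
    simp only [contractTerm_apply, leftTerm_apply, rightTerm_apply, add_apply, smul_apply,
      sum_apply, smul_add, Finset.sum_add_distrib]
    abel
  map_smul' c f := by
    have : SMulCommClass A ℂ X := IsScalarTower.to_smulCommClass'
    have : SMulCommClass Aᵐᵒᵖ ℂ X := IsScalarTower.to_smulCommClass'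
    ext a
    simp only [contractTerm_apply, leftTerm_apply, rightTerm_apply, add_apply, smul_apply,
      sum_apply, smul_add, Finset.smul_sum, smul_comm _ c, RingHom.id_apply]

/-- The space of cocycles `Z^n(A, X) = ker δ^n`. -/
def cocycles (n : ℕ) : Submodule ℂ (Cochain A X n) := LinearMap.ker (coboundary A X n)

/-- The space of coboundaries `N^n(A, X) = im δ^{n-1}`, with `N^0(A, X) = 0`. -/
def coboundaries : (n : ℕ) → Submodule ℂ (Cochain A X n)
  | 0 => ⊥
  | n + 1 => LinearMap.range (coboundary A X n)

/-- The cohomology group `H^n(A, X) = Z^n(A, X) / N^n(A, X)`, with the quotient seminorm. -/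
abbrev Cohomology (n : ℕ) : Type _ :=
  cocycles A X n ⧸ (coboundaries A X n).comap (cocycles A X n).subtype

variable {A}

/-- `C^n_S(A, X)`: the `S`-relative `n`-cochains, for a subalgebra `S` of `A`.
For `n = 0` this is the `S`-centre `{x : s · x = x · s for all s ∈ S}` of `X`. -/
def relativeCochains (S : NonUnitalSubalgebra ℂ A) :
    (n : ℕ) → Submodule ℂ (Cochain A X n)
  | 0 =>
    { carrier := {f | ∀ s ∈ S, ∀ a, s • f a = MulOpposite.op s • f a}
      add_mem' := fun hf hg s hs a => by simp [hf s hs a, hg s hs a]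
      zero_mem' := fun s hs a => by simp
      smul_mem' := fun c f hf s hs a => by
        have : SMulCommClass A ℂ X := IsScalarTower.to_smulCommClass'
        have : SMulCommClass Aᵐᵒᵖ ℂ X := IsScalarTower.to_smulCommClass'
        simp [smul_comm _ c, hf s hs a] }
  | n + 1 =>
    { carrier := {f | ∀ s ∈ S, ∀ a : Fin (n + 1) → A,
        f (Function.update a 0 (s * a 0)) = s • f a ∧
        (∀ i : Fin n, f (Function.update a i.castSucc (a i.castSucc * s)) =
          f (Function.update a i.succ (s * a i.succ))) ∧
        f (Function.update a (Fin.last n) (a (Fin.last n) * s)) = MulOpposite.op s • f a}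
      add_mem' := fun {f g} hf hg s hs a => by
        obtain ⟨h₁, h₂, h₃⟩ := hf s hs a
        obtain ⟨k₁, k₂, k₃⟩ := hg s hs a
        refine ⟨?_, fun i => ?_, ?_⟩
        · simp only [add_apply, h₁, k₁, smul_add]
        · simp only [add_apply, h₂, k₂]
        · simp only [add_apply, h₃, k₃, smul_add]
      zero_mem' := fun s hs a => by simp
      smul_mem' := fun c f hf s hs a => by
        have : SMulCommClass A ℂ X := IsScalarTower.to_smulCommClass'
        have : SMulCommClass Aᵐᵒᵖ ℂ X := IsScalarTower.to_smulCommClass'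
        obtain ⟨h₁, h₂, h₃⟩ := hf s hs a
        refine ⟨?_, fun i => ?_, ?_⟩
        · simp only [smul_apply, h₁, smul_comm s c]
        · simp only [smul_apply, h₂]
        · simp only [smul_apply, h₃, smul_comm _ c] }

end Bimodule

end Cohomology

/-! ## The dual bimodule `A^*` -/

section Dual

/-- The dual Banach space `A^*` of a Banach algebra `A`, as a Banach `A`-bimodule:
`(a · φ)(b) = φ(b a)` and `(φ · a)(b) = φ(a b)`. -/
def DualBimodule (A : Type*) [NormedRing A] [NormedAlgebra ℂ A] : Type _ := A →L[ℂ] ℂ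

variable {A : Type*} [NormedRing A] [NormedAlgebra ℂ A]

instance : NormedAddCommGroup (DualBimodule A) := inferInstanceAs (NormedAddCommGroup (A →L[ℂ] ℂ))
instance : NormedSpace ℂ (DualBimodule A) := inferInstanceAs (NormedSpace ℂ (A →L[ℂ] ℂ))
instance : FunLike (DualBimodule A) A ℂ := inferInstanceAs (FunLike (A →L[ℂ] ℂ) A ℂ)

instance : ContinuousLinearMapClass (DualBimodule A) ℂ A ℂ :=
  inferInstanceAs (ContinuousLinearMapClass (A →L[ℂ] ℂ) ℂ A ℂ)

namespace DualBimodule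

@[ext] theorem ext {φ ψ : DualBimodule A} (h : ∀ b, φ b = ψ b) : φ = ψ :=
  ContinuousLinearMap.ext h

@[simp] theorem add_apply (φ ψ : DualBimodule A) (b : A) : (φ + ψ) b = φ b + ψ b := rfl
@[simp] theorem zero_apply (b : A) : (0 : DualBimodule A) b = 0 := rfl
@[simp] theorem smul_apply (c : ℂ) (φ : DualBimodule A) (b : A) : (c • φ) b = c * φ b := rfl

instance : SMul A (DualBimodule A) where
  smul a φ := ContinuousLinearMap.comp (show A →L[ℂ] ℂ from φ)
    ((ContinuousLinearMap.mul ℂ A).flip a)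

instance : SMul Aᵐᵒᵖ (DualBimodule A) where
  smul a φ := ContinuousLinearMap.comp (show A →L[ℂ] ℂ from φ)
    (ContinuousLinearMap.mul ℂ A a.unop)

@[simp] theorem left_smul_apply (a : A) (φ : DualBimodule A) (b : A) :
    (a • φ) b = φ (b * a) := rfl

@[simp] theorem right_smul_apply (a : Aᵐᵒᵖ) (φ : DualBimodule A) (b : A) :
    (a • φ) b = φ (a.unop * b) := rfl

instance : Module A (DualBimodule A) where
  one_smul φ := by ext b; simp
  mul_smul a a' φ := by ext b; simp [mul_assoc]
  smul_zero a := by ext b; simp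
  smul_add a φ ψ := by ext b; simp
  add_smul a a' φ := by ext b; simp [mul_add]
  zero_smul φ := by ext b; simp

instance : Module Aᵐᵒᵖ (DualBimodule A) where
  one_smul φ := by ext b; simp
  mul_smul a a' φ := by ext b; simp [mul_assoc]
  smul_zero a := by ext b; simp
  smul_add a φ ψ := by ext b; simp
  add_smul a a' φ := by ext b; simp [add_mul]
  zero_smul φ := by ext b; simp

instance : SMulCommClass A Aᵐᵒᵖ (DualBimodule A) where
  smul_comm a a' φ := by ext b; simp [mul_assoc]

instance : IsScalarTower ℂ A (DualBimodule A) where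
  smul_assoc c a φ := by ext b; simp

instance : IsScalarTower ℂ Aᵐᵒᵖ (DualBimodule A) where
  smul_assoc c a φ := by ext b; simp

instance : ContinuousSMul A (DualBimodule A) where
  continuous_smul :=
    (((ContinuousLinearMap.compL ℂ A A ℂ).continuous.comp continuous_snd).clm_apply
      ((ContinuousLinearMap.mul ℂ A).flip.continuous.comp continuous_fst) :
      Continuous fun p : A × (A →L[ℂ] ℂ) => p.2.comp ((ContinuousLinearMap.mul ℂ A).flip p.1))

instance : ContinuousSMul Aᵐᵒᵖ (DualBimodule A) where
  continuous_smul :=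
    (((ContinuousLinearMap.compL ℂ A A ℂ).continuous.comp continuous_snd).clm_apply
      ((ContinuousLinearMap.mul ℂ A).continuous.comp
        (MulOpposite.continuous_unop.comp continuous_fst)) :
      Continuous fun p : Aᵐᵒᵖ × (A →L[ℂ] ℂ) => p.2.comp (ContinuousLinearMap.mul ℂ A p.1.unop))

/-- The adjoint `B^* → A^*`, `φ ↦ φ ∘ π`, of a bounded linear map `π : A → B`. -/
def adjoint {B : Type*} [NormedRing B] [NormedAlgebra ℂ B] (π : A →L[ℂ] B) :
    DualBimodule B →L[ℂ] DualBimodule A :=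
  (ContinuousLinearMap.compL ℂ A B ℂ).flip π

@[simp] theorem adjoint_apply {B : Type*} [NormedRing B] [NormedAlgebra ℂ B]
    (π : A →L[ℂ] B) (φ : DualBimodule B) (a : A) : adjoint π φ a = φ (π a) := rfl

end DualBimodule

end Dual

/-! ## Maps induced by homomorphisms -/

section Induced

variable {A B : Type*} [NormedRing A] [NormedAlgebra ℂ A] [NormedRing B] [NormedAlgebra ℂ B]

/-- The map `C^n(B, B^*) → C^n(A, A^*)` induced by a bounded linear map `π : A → B`:
`f ↦ ((a 1, …, a n) ↦ f (π (a 1), …, π (a n)) ∘ π)`. -/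
def pullback (π : A →L[ℂ] B) (n : ℕ) :
    Cochain B (DualBimodule B) n →ₗ[ℂ] Cochain A (DualBimodule A) n where
  toFun f := (DualBimodule.adjoint π).compContinuousMultilinearMap
    (f.compContinuousLinearMap fun _ => π)
  map_add' f g := by ext a b; simp
  map_smul' c f := by ext a b; simp

@[simp] theorem pullback_apply (π : A →L[ℂ] B) (n : ℕ) (f : Cochain B (DualBimodule B) n)
    (a : Fin n → A) (a₀ : A) : pullback π n f a a₀ = f (fun i => π (a i)) (π a₀) := rfl

theorem dual_sum_apply {ι : Type*} (s : Finset ι) (φ : ι → DualBimodule A) (b : A) :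
    (∑ i ∈ s, φ i) b = ∑ i ∈ s, φ i b :=
  sum_apply (F := A →L[ℂ] ℂ) s φ b

theorem pullback_coboundary (π : A →L[ℂ] B) (hπ : ∀ x y, π (x * y) = π x * π y) (n : ℕ)
    (f : Cochain B (DualBimodule B) n) :
    pullback π (n + 1) (coboundary B _ n f) = coboundary A _ n (pullback π n f) := by
  have key : ∀ (a : Fin (n + 1) → A) (i : Fin n),
      Fin.contractNth i.castSucc (· * ·) (fun j => π (a j)) =
        fun j => π (Fin.contractNth i.castSucc (· * ·) a j) := by
    intro a i
    ext j
    simp only [Fin.contractNth]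
    split_ifs <;> simp [hπ]
  ext a b
  simp only [coboundary, LinearMap.coe_mk, AddHom.coe_mk, pullback_apply,
    add_apply, smul_apply,
    sum_apply, DualBimodule.add_apply, DualBimodule.smul_apply,
    dual_sum_apply]
  have h₁ : leftTerm f (fun i => π (a i)) (π b) = leftTerm (pullback π n f) a b :=
    congrArg (f fun i => π (a i.succ)) (hπ b (a 0)).symm
  have h₂ : rightTerm f (fun i => π (a i)) (π b) = rightTerm (pullback π n f) a b :=
    congrArg (f fun i => π (a i.castSucc)) (hπ (a (Fin.last n)) b).symm
  have h₃ : ∀ i, contractTerm f i (fun i => π (a i)) (π b) =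
      contractTerm (pullback π n f) i a b := fun i =>
    congrArg (fun c => f c (π b)) (key a i)
  rw [h₁, h₂]
  simp only [h₃]

theorem pullback_mem_cocycles (π : A →L[ℂ] B) (hπ : ∀ x y, π (x * y) = π x * π y) (n : ℕ)
    (f : cocycles B (DualBimodule B) n) :
    pullback π n f ∈ cocycles A (DualBimodule A) n := by
  have hf : coboundary B _ n (f : Cochain B (DualBimodule B) n) = 0 := f.2
  change coboundary A _ n _ = 0
  rw [← pullback_coboundary π hπ, hf, map_zero]

/-- The map `Z^n(B, B^*) → Z^n(A, A^*)` induced by a bounded homomorphism `π : A → B`. -/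
def pullbackCocycles (π : A →L[ℂ] B) (hπ : ∀ x y, π (x * y) = π x * π y) (n : ℕ) :
    cocycles B (DualBimodule B) n →ₗ[ℂ] cocycles A (DualBimodule A) n :=
  ((pullback π n).comp (cocycles B (DualBimodule B) n).subtype).codRestrict _
    (pullback_mem_cocycles π hπ n)

/-- The map `H^n(B, B^*) → H^n(A, A^*)` induced by a bounded homomorphism `π : A → B`. -/
def inducedMap (π : A →L[ℂ] B) (hπ : ∀ x y, π (x * y) = π x * π y) (n : ℕ) :
    Cohomology B (DualBimodule B) n →ₗ[ℂ] Cohomology A (DualBimodule A) n :=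
  Submodule.mapQ _ _ (pullbackCocycles π hπ n) (by
    rintro f hf
    change pullback π n f ∈ coboundaries A (DualBimodule A) n
    cases n with
    | zero =>
      have h : (f : Cochain B (DualBimodule B) 0) = 0 := hf
      rw [h, map_zero]
      exact Submodule.zero_mem _
    | succ n =>
      obtain ⟨g, hg⟩ : ∃ g, coboundary B _ n g = (f : Cochain B (DualBimodule B) (n + 1)) := hf
      exact ⟨pullback π n g, by rw [← hg, pullback_coboundary π hπ]⟩)

end Induced

/-! ## The triangular matrix algebra -/

/-- The upper triangular matrices with diagonal entries `r₁ ∈ A₁`, `r₂ ∈ A₂` and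
off-diagonal entry `y ∈ Y`. -/
@[ext] structure Triangular (A₁ A₂ Y : Type*) where
  r₁ : A₁
  y : Y
  r₂ : A₂

/-- A jointly continuous module action is bounded: `‖a • z‖ ≤ K * ‖a‖ * ‖z‖`. -/
theorem exists_bound_smul (R Y : Type*) [NormedRing R] [NormedAlgebra ℂ R]
    [NormedAddCommGroup Y] [NormedSpace ℂ Y] [Module R Y] [IsScalarTower ℂ R Y]
    [ContinuousSMul R Y] :
    ∃ K : ℝ, 1 ≤ K ∧ ∀ (a : R) (z : Y), ‖a • z‖ ≤ K * ‖a‖ * ‖z‖ := by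
  have hc : Continuous fun p : R × Y => p.1 • p.2 := continuous_smul
  obtain ⟨δ, hδ, h⟩ := Metric.continuous_iff.1 hc 0 1 one_pos
  have : SMulCommClass R ℂ Y := IsScalarTower.to_smulCommClass'
  refine ⟨max 1 (4 / δ ^ 2), le_max_left _ _, fun a z => ?_⟩
  rcases eq_or_ne a 0 with rfl | ha
  · simp
  rcases eq_or_ne z 0 with rfl | hz
  · simp
  have ha' := norm_pos_iff.2 ha
  have hz' := norm_pos_iff.2 hz
  have hs : ∀ {t : ℝ}, 0 < t → ‖((δ / 2 / t : ℝ) : ℂ)‖ = δ / 2 / t := fun {t} ht => by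
    rw [Complex.norm_real, Real.norm_of_nonneg (by positivity)]
  have hlt := h (((δ / 2 / ‖a‖ : ℝ) : ℂ) • a, ((δ / 2 / ‖z‖ : ℝ) : ℂ) • z) (by
    rw [dist_zero_right, Prod.norm_def, norm_smul, norm_smul, hs ha', hs hz',
      div_mul_cancel₀ _ ha'.ne', div_mul_cancel₀ _ hz'.ne', max_self]
    linarith)
  simp only [Prod.fst_zero, Prod.snd_zero, smul_zero, dist_zero_right] at hlt
  rw [smul_comm, smul_assoc, norm_smul, norm_smul, hs ha', hs hz'] at hlt
  have h4 : ‖a • z‖ ≤ 4 / δ ^ 2 * ‖a‖ * ‖z‖ := by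
    have : δ / 2 / ‖z‖ * (δ / 2 / ‖a‖ * ‖a • z‖) = ‖a • z‖ / (4 / δ ^ 2 * ‖a‖ * ‖z‖) := by
      field_simp
      ring
    rw [this, div_lt_one (by positivity)] at hlt
    exact hlt.le
  refine h4.trans ?_
  gcongr
  exact le_max_right _ _

namespace Triangular

section Algebra

variable {A₁ A₂ Y : Type*} [Ring A₁] [Algebra ℂ A₁] [Ring A₂] [Algebra ℂ A₂]
variable [AddCommGroup Y] [Module ℂ Y] [Module A₁ Y] [Module A₂ᵐᵒᵖ Y]
variable [SMulCommClass A₁ A₂ᵐᵒᵖ Y] [IsScalarTower ℂ A₁ Y] [IsScalarTower ℂ A₂ᵐᵒᵖ Y]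

instance : Zero (Triangular A₁ A₂ Y) := ⟨⟨0, 0, 0⟩⟩
instance : One (Triangular A₁ A₂ Y) := ⟨⟨1, 0, 1⟩⟩
instance : Add (Triangular A₁ A₂ Y) := ⟨fun u v => ⟨u.r₁ + v.r₁, u.y + v.y, u.r₂ + v.r₂⟩⟩
instance : Neg (Triangular A₁ A₂ Y) := ⟨fun u => ⟨-u.r₁, -u.y, -u.r₂⟩⟩
instance : SMul ℂ (Triangular A₁ A₂ Y) := ⟨fun c u => ⟨c • u.r₁, c • u.y, c • u.r₂⟩⟩

/-- Matrix multiplication. -/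
instance : Mul (Triangular A₁ A₂ Y) :=
  ⟨fun u v => ⟨u.r₁ * v.r₁, u.r₁ • v.y + MulOpposite.op v.r₂ • u.y, u.r₂ * v.r₂⟩⟩

@[simp] theorem zero_r₁ : (0 : Triangular A₁ A₂ Y).r₁ = 0 := rfl
@[simp] theorem zero_y : (0 : Triangular A₁ A₂ Y).y = 0 := rfl
@[simp] theorem zero_r₂ : (0 : Triangular A₁ A₂ Y).r₂ = 0 := rfl
@[simp] theorem one_r₁ : (1 : Triangular A₁ A₂ Y).r₁ = 1 := rfl
@[simp] theorem one_y : (1 : Triangular A₁ A₂ Y).y = 0 := rfl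
@[simp] theorem one_r₂ : (1 : Triangular A₁ A₂ Y).r₂ = 1 := rfl
@[simp] theorem add_r₁ (u v : Triangular A₁ A₂ Y) : (u + v).r₁ = u.r₁ + v.r₁ := rfl
@[simp] theorem add_y (u v : Triangular A₁ A₂ Y) : (u + v).y = u.y + v.y := rfl
@[simp] theorem add_r₂ (u v : Triangular A₁ A₂ Y) : (u + v).r₂ = u.r₂ + v.r₂ := rfl
@[simp] theorem neg_r₁ (u : Triangular A₁ A₂ Y) : (-u).r₁ = -u.r₁ := rfl
@[simp] theorem neg_y (u : Triangular A₁ A₂ Y) : (-u).y = -u.y := rfl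
@[simp] theorem neg_r₂ (u : Triangular A₁ A₂ Y) : (-u).r₂ = -u.r₂ := rfl
@[simp] theorem smul_r₁ (c : ℂ) (u : Triangular A₁ A₂ Y) : (c • u).r₁ = c • u.r₁ := rfl
@[simp] theorem smul_y (c : ℂ) (u : Triangular A₁ A₂ Y) : (c • u).y = c • u.y := rfl
@[simp] theorem smul_r₂ (c : ℂ) (u : Triangular A₁ A₂ Y) : (c • u).r₂ = c • u.r₂ := rfl
@[simp] theorem mul_r₁ (u v : Triangular A₁ A₂ Y) : (u * v).r₁ = u.r₁ * v.r₁ := rfl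
@[simp] theorem mul_y (u v : Triangular A₁ A₂ Y) :
    (u * v).y = u.r₁ • v.y + MulOpposite.op v.r₂ • u.y := rfl
@[simp] theorem mul_r₂ (u v : Triangular A₁ A₂ Y) : (u * v).r₂ = u.r₂ * v.r₂ := rfl

/-- The ring of triangular matrices. -/
instance instRing : Ring (Triangular A₁ A₂ Y) where
  add_assoc u v w := by ext <;> simp [add_assoc]
  zero_add u := by ext <;> simp
  add_zero u := by ext <;> simp
  add_comm u v := by ext <;> simp [add_comm]
  neg_add_cancel u := by ext <;> simp
  left_distrib u v w := by ext <;> simp [mul_add, add_smul]; abel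
  right_distrib u v w := by ext <;> simp [add_mul, add_smul]; abel
  zero_mul u := by ext <;> simp
  mul_zero u := by ext <;> simp
  mul_assoc u v w := by
    ext
    · simp [mul_assoc]
    · simp [mul_smul, smul_comm, add_assoc]
    · simp [mul_assoc]
  one_mul u := by ext <;> simp
  mul_one u := by ext <;> simp
  nsmul := nsmulRec
  zsmul := zsmulRec

instance instModule : Module ℂ (Triangular A₁ A₂ Y) where
  one_smul u := by ext <;> simp
  mul_smul c d u := by ext <;> simp [mul_smul]
  smul_zero c := by ext <;> simp
  smul_add c u v := by ext <;> simp
  add_smul c d u := by ext <;> simp [add_smul]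
  zero_smul u := by ext <;> simp

instance instAlgebra : Algebra ℂ (Triangular A₁ A₂ Y) :=
  Algebra.ofModule
    (fun c u v => by
      have : SMulCommClass A₂ᵐᵒᵖ ℂ Y := IsScalarTower.to_smulCommClass'
      ext
      · simp
      · simp [smul_comm _ c]
      · simp)
    (fun c u v => by
      have : SMulCommClass A₁ ℂ Y := IsScalarTower.to_smulCommClass'
      ext
      · simp
      · simp [smul_comm _ c]
      · simp)

end Algebra

section Normed

variable (A₁ A₂ Y : Type*) [NormedRing A₁] [NormedAlgebra ℂ A₁]
variable [NormedRing A₂] [NormedAlgebra ℂ A₂]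
variable [NormedAddCommGroup Y] [NormedSpace ℂ Y] [Module A₁ Y] [Module A₂ᵐᵒᵖ Y]
variable [SMulCommClass A₁ A₂ᵐᵒᵖ Y] [IsScalarTower ℂ A₁ Y] [IsScalarTower ℂ A₂ᵐᵒᵖ Y]
variable [ContinuousSMul A₁ Y] [ContinuousSMul A₂ᵐᵒᵖ Y]

/-- The space of columns `((d₁, z), d₂)`, with norm `max (‖d₁‖ + ‖z‖) ‖d₂‖`, on which
triangular matrices act. -/
abbrev Column : Type _ := WithLp 1 (A₁ × Y) × A₂

variable {A₁ A₂ Y}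

theorem Column.ext {d d' : Column A₁ A₂ Y} (h₁ : d.1.fst = d'.1.fst)
    (h₂ : d.1.snd = d'.1.snd) (h₃ : d.2 = d'.2) : d = d' :=
  Prod.ext (WithLp.ofLp_injective 1 (Prod.ext h₁ h₂)) h₃

/-- The action `((d₁, z), d₂) ↦ ((r₁ d₁, r₁ z + y d₂), r₂ d₂)` of a triangular matrix, i.e.
multiplication from the left. -/
def leftMul (u : Triangular A₁ A₂ Y) : Column A₁ A₂ Y →L[ℂ] Column A₁ A₂ Y where
  toFun d := (WithLp.toLp 1 (u.r₁ * d.1.fst, u.r₁ • d.1.snd + MulOpposite.op d.2 • u.y),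
    u.r₂ * d.2)
  map_add' d d' := by
    apply Column.ext <;> simp [mul_add, add_smul]
    abel
  map_smul' c d := by
    have : SMulCommClass A₁ ℂ Y := IsScalarTower.to_smulCommClass'
    apply Column.ext <;> simp [smul_comm _ c]
  cont := by
    have h₁ : Continuous fun d : Column A₁ A₂ Y => d.1.fst :=
      continuous_fst.comp ((WithLp.prod_continuous_ofLp 1 A₁ Y).comp continuous_fst)
    have h₂ : Continuous fun d : Column A₁ A₂ Y => d.1.snd :=
      continuous_snd.comp ((WithLp.prod_continuous_ofLp 1 A₁ Y).comp continuous_fst)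
    refine Continuous.prodMk ((WithLp.prod_continuous_toLp 1 A₁ Y).comp
      (Continuous.prodMk (continuous_const.mul h₁) (Continuous.add ?_ ?_)))
      (continuous_const.mul continuous_snd)
    · exact h₂.const_smul u.r₁
    · exact (MulOpposite.continuous_op.comp continuous_snd).smul continuous_const

theorem leftMul_apply (u : Triangular A₁ A₂ Y) (d : Column A₁ A₂ Y) :
    leftMul u d = (WithLp.toLp 1 (u.r₁ * d.1.fst, u.r₁ • d.1.snd + MulOpposite.op d.2 • u.y),
      u.r₂ * d.2) := rfl

variable (A₁ A₂ Y) in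
/-- `leftMul` as a homomorphism of algebras. -/
def leftMulHom : Triangular A₁ A₂ Y →ₐ[ℂ] (Column A₁ A₂ Y →L[ℂ] Column A₁ A₂ Y) :=
  AlgHom.ofLinearMap
    { toFun := leftMul
      map_add' := fun u v => by
        refine ContinuousLinearMap.ext fun d => Column.ext ?_ ?_ ?_ <;>
          simp [leftMul_apply, add_mul, add_smul]
        abel
      map_smul' := fun c u => by
        have : SMulCommClass A₂ᵐᵒᵖ ℂ Y := IsScalarTower.to_smulCommClass'
        refine ContinuousLinearMap.ext fun d => Column.ext ?_ ?_ ?_ <;>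
          simp [leftMul_apply, smul_comm _ c] }
    (by refine ContinuousLinearMap.ext fun d => Column.ext ?_ ?_ ?_ <;> simp [leftMul_apply])
    (fun u v => by
      refine ContinuousLinearMap.ext fun d => Column.ext ?_ ?_ ?_
      · simp [leftMul_apply, mul_assoc]
      · simp [leftMul_apply, mul_smul, add_assoc]
        exact (smul_comm _ _ _).symm
      · simp [leftMul_apply, mul_assoc])

theorem leftMulHom_injective : Function.Injective (leftMulHom A₁ A₂ Y) := by
  intro u v h
  have h' : leftMul u (WithLp.toLp 1 (1, 0), 1) = leftMul v (WithLp.toLp 1 (1, 0), 1) :=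
    congrArg (fun T : Column A₁ A₂ Y →L[ℂ] Column A₁ A₂ Y => T (WithLp.toLp 1 (1, 0), 1)) h
  simp only [leftMul_apply, Prod.mk.injEq, (WithLp.toLp_injective 1).eq_iff] at h'
  ext
  · simpa using h'.1.1
  · simpa using h'.1.2
  · simpa using h'.2

/-- The Banach algebra norm on the triangular matrices: the operator norm of left
multiplication, `‖u‖ = sup max (‖r₁ d₁‖ + ‖r₁ z + y d₂‖) ‖r₂ d₂‖`, over `d₁ ∈ A₁`, `z ∈ Y`,
`d₂ ∈ A₂` with `‖d₁‖ + ‖z‖ ≤ 1` and `‖d₂‖ ≤ 1`. -/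
instance instNormedRing : NormedRing (Triangular A₁ A₂ Y) :=
  { instRing, MetricSpace.induced (leftMulHom A₁ A₂ Y) leftMulHom_injective inferInstance with
    norm := fun u => ‖leftMul u‖
    dist_eq := fun u v => by
      change dist (leftMulHom A₁ A₂ Y u) (leftMulHom A₁ A₂ Y v) = ‖leftMulHom A₁ A₂ Y (-u + v)‖
      rw [map_add, map_neg]
      exact dist_eq_norm_neg_add (leftMul u) (leftMul v)
    norm_mul_le := fun u v => by
      change ‖leftMulHom A₁ A₂ Y (u * v)‖ ≤ ‖leftMulHom A₁ A₂ Y u‖ * ‖leftMulHom A₁ A₂ Y v‖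
      rw [map_mul]
      exact ContinuousLinearMap.opNorm_comp_le (leftMul u) (leftMul v) }

instance instNormedAlgebra : NormedAlgebra ℂ (Triangular A₁ A₂ Y) :=
  { instAlgebra with
    norm_smul_le := fun c u => by
      change ‖leftMulHom A₁ A₂ Y (c • u)‖ ≤ ‖c‖ * ‖leftMulHom A₁ A₂ Y u‖
      rw [map_smul]
      exact ContinuousLinearMap.opNorm_smul_le c (leftMul u) }

theorem norm_def (u : Triangular A₁ A₂ Y) : ‖u‖ = ‖leftMul u‖ := rfl

theorem norm_le {K₁ K₂ : ℝ} (hK₁ : ∀ (a : A₁) (z : Y), ‖a • z‖ ≤ K₁ * ‖a‖ * ‖z‖) (h₁ : 1 ≤ K₁)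
    (hK₂ : ∀ (b : A₂ᵐᵒᵖ) (z : Y), ‖b • z‖ ≤ K₂ * ‖b‖ * ‖z‖) (h₂ : 0 ≤ K₂)
    (u : Triangular A₁ A₂ Y) : ‖u‖ ≤ max (K₁ * ‖u.r₁‖ + K₂ * ‖u.y‖) ‖u.r₂‖ := by
  refine ContinuousLinearMap.opNorm_le_bound (leftMul u)
    (le_max_of_le_right (norm_nonneg _)) fun d => ?_
  rw [leftMul_apply, Prod.norm_def, WithLp.prod_norm_eq_of_L1]
  have hd₁ : ‖d.1.fst‖ + ‖d.1.snd‖ ≤ ‖d‖ := by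
    rw [← WithLp.prod_norm_eq_of_L1]; exact norm_fst_le d
  have hd₂ : ‖d.2‖ ≤ ‖d‖ := norm_snd_le d
  have e₁ : ‖u.r₁ * d.1.fst‖ ≤ K₁ * ‖u.r₁‖ * ‖d.1.fst‖ := by
    refine (norm_mul_le _ _).trans ?_
    gcongr
    nlinarith [norm_nonneg u.r₁]
  have e₂ : ‖u.r₁ • d.1.snd + MulOpposite.op d.2 • u.y‖ ≤
      K₁ * ‖u.r₁‖ * ‖d.1.snd‖ + K₂ * ‖d.2‖ * ‖u.y‖ := by
    refine (norm_add_le _ _).trans (add_le_add (hK₁ _ _) ?_)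
    exact hK₂ (MulOpposite.op d.2) u.y
  have e₃ : ‖u.r₂ * d.2‖ ≤ ‖u.r₂‖ * ‖d.2‖ := norm_mul_le _ _
  refine max_le ?_ ?_
  · calc _ ≤ K₁ * ‖u.r₁‖ * (‖d.1.fst‖ + ‖d.1.snd‖) + K₂ * ‖u.y‖ * ‖d.2‖ := by
            change ‖u.r₁ * d.1.fst‖ + ‖u.r₁ • d.1.snd + MulOpposite.op d.2 • u.y‖ ≤ _
            linarith
      _ ≤ K₁ * ‖u.r₁‖ * ‖d‖ + K₂ * ‖u.y‖ * ‖d‖ := by gcongr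
      _ = (K₁ * ‖u.r₁‖ + K₂ * ‖u.y‖) * ‖d‖ := by ring
      _ ≤ _ := by gcongr; exact le_max_left _ _
  · calc _ ≤ ‖u.r₂‖ * ‖d.2‖ := e₃
      _ ≤ ‖u.r₂‖ * ‖d‖ := by gcongr
      _ ≤ _ := by gcongr; exact le_max_right _ _

/-- If the identities of `A₁` and `A₂` have norm one and the actions on `Y` are contractive, then
the norm of `u` is the supremum of `max (‖r₁ d₁‖ + ‖y d₂‖) ‖r₂ d₂‖` over the unit balls of `A₁`
and `A₂`, and the supremum is `max (‖r₁‖ + ‖y‖) ‖r₂‖`. -/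
theorem norm_eq_sup [NormOneClass A₁] [NormOneClass A₂]
    (hA₁ : ∀ (a : A₁) (z : Y), ‖a • z‖ ≤ ‖a‖ * ‖z‖)
    (hA₂ : ∀ (b : A₂ᵐᵒᵖ) (z : Y), ‖b • z‖ ≤ ‖b‖ * ‖z‖) (u : Triangular A₁ A₂ Y) :
    IsLUB {t : ℝ | ∃ (d₁ : A₁) (d₂ : A₂), ‖d₁‖ ≤ 1 ∧ ‖d₂‖ ≤ 1 ∧
      t = max (‖u.r₁ * d₁‖ + ‖MulOpposite.op d₂ • u.y‖) ‖u.r₂ * d₂‖} ‖u‖ ∧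
    ‖u‖ = max (‖u.r₁‖ + ‖u.y‖) ‖u.r₂‖ := by
  have hle : ‖u‖ ≤ max (‖u.r₁‖ + ‖u.y‖) ‖u.r₂‖ := by
    simpa using norm_le (K₁ := 1) (K₂ := 1) (by simpa using hA₁) le_rfl (by simpa using hA₂)
      zero_le_one u
  have hub : ‖u‖ ∈ upperBounds {t : ℝ | ∃ (d₁ : A₁) (d₂ : A₂), ‖d₁‖ ≤ 1 ∧ ‖d₂‖ ≤ 1 ∧
      t = max (‖u.r₁ * d₁‖ + ‖MulOpposite.op d₂ • u.y‖) ‖u.r₂ * d₂‖} := by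
    rintro t ⟨d₁, d₂, h₁, h₂, rfl⟩
    have h := (leftMul u).le_opNorm (WithLp.toLp 1 (d₁, 0), d₂)
    rw [leftMul_apply, Prod.norm_def, Prod.norm_def, WithLp.prod_norm_eq_of_L1,
      WithLp.prod_norm_eq_of_L1] at h
    simp only [WithLp.toLp_fst, WithLp.toLp_snd, smul_zero, zero_add, norm_zero, add_zero] at h
    refine h.trans ?_
    rw [norm_def]
    exact mul_le_of_le_one_right (norm_nonneg _) (max_le h₁ h₂)
  have hmem : max (‖u.r₁‖ + ‖u.y‖) ‖u.r₂‖ ∈ {t : ℝ | ∃ (d₁ : A₁) (d₂ : A₂), ‖d₁‖ ≤ 1 ∧ ‖d₂‖ ≤ 1 ∧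
      t = max (‖u.r₁ * d₁‖ + ‖MulOpposite.op d₂ • u.y‖) ‖u.r₂ * d₂‖} :=
    ⟨1, 1, by simp, by simp, by simp⟩
  exact ⟨⟨hub, fun b hb => hle.trans (hb hmem)⟩, le_antisymm hle (hub hmem)⟩

theorem continuous_leftMul :
    Continuous (leftMul : Triangular A₁ A₂ Y → Column A₁ A₂ Y →L[ℂ] Column A₁ A₂ Y) :=
  continuous_induced_dom

variable (A₁ A₂ Y)

/-- The topology of the triangular matrix algebra is the product topology. -/
def toProd : Triangular A₁ A₂ Y ≃L[ℂ] A₁ × Y × A₂ where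
  toFun u := (u.r₁, u.y, u.r₂)
  invFun p := ⟨p.1, p.2.1, p.2.2⟩
  map_add' _ _ := rfl
  map_smul' _ _ := rfl
  continuous_toFun := by
    have h : Continuous fun u : Triangular A₁ A₂ Y =>
        leftMul u (WithLp.toLp 1 (1, 0), 1) := continuous_leftMul.clm_apply continuous_const
    have h₁ : Continuous fun u : Triangular A₁ A₂ Y => WithLp.ofLp
        (leftMul u (WithLp.toLp 1 (1, 0), 1)).1 :=
      (WithLp.prod_continuous_ofLp 1 A₁ Y).comp (continuous_fst.comp h)
    have h₂ := continuous_snd.comp h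
    simp only [leftMul_apply, WithLp.toLp_fst, WithLp.toLp_snd, mul_one, smul_zero, zero_add, MulOpposite.op_one, one_smul,
      Function.comp_def] at h₁ h₂
    exact (continuous_fst.comp h₁).prodMk ((continuous_snd.comp h₁).prodMk h₂)
  continuous_invFun := by
    obtain ⟨K₁, h₁, hK₁⟩ := exists_bound_smul A₁ Y
    obtain ⟨K₂, h₂, hK₂⟩ := exists_bound_smul A₂ᵐᵒᵖ Y
    let e : A₁ × Y × A₂ →ₗ[ℂ] Triangular A₁ A₂ Y :=
      { toFun := fun p => ⟨p.1, p.2.1, p.2.2⟩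
        map_add' := fun _ _ => rfl
        map_smul' := fun _ _ => rfl }
    refine (e.mkContinuous (K₁ + K₂ + 1) fun p => ?_).continuous
    refine (norm_le hK₁ h₁ hK₂ (zero_le_one.trans h₂) (e p)).trans ?_
    have e₁ : ‖p.1‖ ≤ ‖p‖ := norm_fst_le p
    have e₂ : ‖p.2.1‖ ≤ ‖p‖ := (norm_fst_le p.2).trans (norm_snd_le p)
    have e₃ : ‖p.2.2‖ ≤ ‖p‖ := (norm_snd_le p.2).trans (norm_snd_le p)
    have e₀ := norm_nonneg p
    refine max_le ?_ ?_
    · calc K₁ * ‖p.1‖ + K₂ * ‖p.2.1‖ ≤ K₁ * ‖p‖ + K₂ * ‖p‖ := by gcongr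
        _ ≤ _ := by nlinarith
    · exact e₃.trans (by nlinarith)

instance [CompleteSpace A₁] [CompleteSpace A₂] [CompleteSpace Y] :
    CompleteSpace (Triangular A₁ A₂ Y) :=
  (completeSpace_congr (e := (toProd A₁ A₂ Y).toEquiv) (toProd A₁ A₂ Y).isUniformEmbedding).2
    inferInstance

/-- The canonical projection onto `A₁`. -/
def proj₁ : Triangular A₁ A₂ Y →L[ℂ] A₁ :=
  (ContinuousLinearMap.fst ℂ A₁ (Y × A₂)).comp (toProd A₁ A₂ Y : Triangular A₁ A₂ Y →L[ℂ] _)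

/-- The canonical projection onto `A₂`. -/
def proj₂ : Triangular A₁ A₂ Y →L[ℂ] A₂ :=
  ((ContinuousLinearMap.snd ℂ Y A₂).comp (ContinuousLinearMap.snd ℂ A₁ (Y × A₂))).comp
    (toProd A₁ A₂ Y : Triangular A₁ A₂ Y →L[ℂ] _)

/-- The inclusion of `A₁` as the upper left corner. -/
def incl₁ : A₁ →L[ℂ] Triangular A₁ A₂ Y :=
  ((toProd A₁ A₂ Y).symm : _ →L[ℂ] Triangular A₁ A₂ Y).comp
    (ContinuousLinearMap.inl ℂ A₁ (Y × A₂))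

/-- The inclusion of `A₂` as the lower right corner. -/
def incl₂ : A₂ →L[ℂ] Triangular A₁ A₂ Y :=
  ((toProd A₁ A₂ Y).symm : _ →L[ℂ] Triangular A₁ A₂ Y).comp
    ((ContinuousLinearMap.inr ℂ A₁ (Y × A₂)).comp (ContinuousLinearMap.inr ℂ Y A₂))

variable {A₁ A₂ Y}

@[simp] theorem proj₁_apply (u : Triangular A₁ A₂ Y) : proj₁ A₁ A₂ Y u = u.r₁ := rfl
@[simp] theorem proj₂_apply (u : Triangular A₁ A₂ Y) : proj₂ A₁ A₂ Y u = u.r₂ := rfl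
@[simp] theorem incl₁_apply (a : A₁) : incl₁ A₁ A₂ Y a = ⟨a, 0, 0⟩ := rfl
@[simp] theorem incl₂_apply (a : A₂) : incl₂ A₁ A₂ Y a = ⟨0, 0, a⟩ := rfl

theorem proj₁_mul (u v : Triangular A₁ A₂ Y) :
    proj₁ A₁ A₂ Y (u * v) = proj₁ A₁ A₂ Y u * proj₁ A₁ A₂ Y v := rfl

theorem proj₂_mul (u v : Triangular A₁ A₂ Y) :
    proj₂ A₁ A₂ Y (u * v) = proj₂ A₁ A₂ Y u * proj₂ A₁ A₂ Y v := rfl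

variable (A₁ A₂ Y)

/-- The Banach subalgebra generated by the idempotents `e₁₁` and `e₂₂`. -/
def diagonalSubalgebra : NonUnitalSubalgebra ℂ (Triangular A₁ A₂ Y) :=
  (NonUnitalAlgebra.adjoin ℂ
    {(⟨1, 0, 0⟩ : Triangular A₁ A₂ Y), (⟨0, 0, 1⟩ : Triangular A₁ A₂ Y)}).topologicalClosure

end Normed

end Triangular

end BanachCohomology

end

/-! A cochain `f` with values in the dual is the scalar function `F (a 0, …, a n) = f (a 1, …, a n)
(a 0)`, whose arguments lie on a cycle. In this form the coboundary is the alternating sum of the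
operators that multiply two neighbouring arguments, the last of which closes the cycle with `a (n +
1) * a 0` (`seqEval_coboundary`).

Let `e = e₁₁`. Both halves of the theorem rest on one operator: it sends `F` to the sum of all `F
(pₙ a₀ p₀, p₀ a₁ p₁, …, pₙ₋₁ aₙ pₙ)`, each `pᵢ` being `e` or `1 - e`. This is `homotopyTerm e n
(coface n (n + 1) F)`. Since `(1 - e) a e = 0`, a nonzero summand never passes from `1 - e` to `e`,
and on a cycle it then cannot change at all. The two constant choices that survive are the pullbacks
of `F` along `a ↦ a e` and `a ↦ (1 - e) a`, the compressions to the diagonal corners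
(`homotopyTerm_coface_last`, `seqEval_diagonal`).

For (a), a relative cochain is balanced over `e` and `1 - e` at every place of the cycle, so the
operator fixes it (`homotopyTerm_coface_last_of_mem_relativeCochains`) and it equals its diagonal
part. Conversely, the projections send the diagonal subalgebra to scalars, so pullbacks along them
are relative.

For (b), inserting `e ⊗ e + (1 - e) ⊗ (1 - e)` behind the entries `0, …, j`, with a new argument
opened behind entry `j`, gives a simplicial homotopy from the identity to the same operator
(`exists_coboundary_eq_sub_homotopyTerm`). So a cocycle is cohomologous to its diagonal part. The
maps in both directions are built from pullbacks, hence continuous without an open mapping argument.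
-/

namespace BanachCohomology

/-! ## The simplicial structure of the complex of cochains with values in the dual -/

noncomputable section Simplicial

variable {A : Type*} [NormedRing A] [NormedAlgebra ℂ A]

/-- The `n`-cochain `f` as the function `a ↦ f (a 1, …, a n) (a 0)` of sequences in `A`. -/
def seqEval (n : ℕ) : Cochain A (DualBimodule A) n →ₗ[ℂ] ((ℕ → A) → ℂ) where
  toFun f a := f (fun i => a (i + 1)) (a 0)
  map_add' _ _ := rfl
  map_smul' _ _ := rfl

theorem seqEval_apply {n : ℕ} (f : Cochain A (DualBimodule A) n) (a : ℕ → A) :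
    seqEval n f a = f (fun i => a (i + 1)) (a 0) := rfl

theorem seqEval_injective (n : ℕ) :
    Function.Injective (seqEval n : Cochain A (DualBimodule A) n → (ℕ → A) → ℂ) := by
  intro f g h
  ext a b
  -- Place `0` holds the argument of the functional, so the tuple is shifted by one; the entries
  -- behind place `n` are irrelevant.
  have := congrFun h (fun k => Nat.casesOn k b fun l => if hl : l < n then a ⟨l, hl⟩ else 0)
  simpa [seqEval_apply] using this

/-- Infinite sequences spare the faces and degeneracies all casts between degrees; this lemma
discards what they leave behind entry `n`. -/
theorem seqEval_congr {n : ℕ} (f : Cochain A (DualBimodule A) n) {a b : ℕ → A}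
    (h : ∀ l ≤ n, a l = b l) : seqEval n f a = seqEval n f b := by
  simp only [seqEval_apply]
  rw [h 0 (Nat.zero_le _), show (fun i : Fin n => a (i + 1)) = fun i : Fin n => b (i + 1) from
    funext fun i => h _ (by omega)]

theorem update_comp_val_succ {n k : ℕ} (hk : k < n) (a : ℕ → A) (x : A) :
    (fun i : Fin n => Function.update a (k + 1) x (i + 1)) =
      Function.update (fun i : Fin n => a (i + 1)) ⟨k, hk⟩ x := by
  ext i
  simp [Function.update_apply, Fin.ext_iff]

theorem seqEval_update_add {n : ℕ} (f : Cochain A (DualBimodule A) n) {k : ℕ} (hk : k ≤ n)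
    (a : ℕ → A) (x y : A) :
    seqEval n f (Function.update a k (x + y)) =
      seqEval n f (Function.update a k x) + seqEval n f (Function.update a k y) := by
  cases k with
  | zero => simp [seqEval_apply]
  | succ k =>
    simp only [seqEval_apply, update_comp_val_succ hk, ContinuousMultilinearMap.map_update_add]
    simp

theorem seqEval_eq_zero {n : ℕ} (f : Cochain A (DualBimodule A) n) {k : ℕ} (hk : k ≤ n)
    (a : ℕ → A) (ha : a k = 0) : seqEval n f a = 0 := by
  -- Additivity at `0 + 0` says that the value is twice itself.
  have := seqEval_update_add f hk a 0 0
  rw [add_zero, Function.update_eq_self_iff.2 ha.symm] at this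
  simpa using this

theorem seqEval_add {n : ℕ} (f : Cochain A (DualBimodule A) n) {k : ℕ} (hk : k ≤ n)
    (a b c : ℕ → A) (hb : ∀ l, l ≠ k → b l = a l) (hc : ∀ l, l ≠ k → c l = a l)
    (h : a k = b k + c k) : seqEval n f a = seqEval n f b + seqEval n f c := by
  have := seqEval_update_add f hk a (b k) (c k)
  rw [← h, Function.update_eq_self] at this
  rw [this]
  refine congrArg₂ (· + ·) (congrArg _ (funext fun l => ?_)) (congrArg _ (funext fun l => ?_)) <;>
    by_cases hl : l = k <;> simp_all

/-- Bounded linear maps in the separate variables act on cochains. -/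
theorem exists_seqEval_map {n : ℕ} (f : Cochain A (DualBimodule A) n) (φ : ℕ → A →L[ℂ] A) :
    ∃ g, seqEval n g = fun a => seqEval n f fun l => φ l (a l) :=
  ⟨(DualBimodule.adjoint (φ 0)).compContinuousMultilinearMap
    (f.compContinuousLinearMap fun i => φ (i + 1)), rfl⟩

/-- Multiply the entries `j` and `j + 1`. -/
def face (j : ℕ) (a : ℕ → A) (l : ℕ) : A :=
  if l < j then a l else if l = j then a l * a (l + 1) else a (l + 1)

/-- Multiply the entries `n + 1` and `0`. -/
def lastFace (n : ℕ) (a : ℕ → A) (l : ℕ) : A := if l = 0 then a (n + 1) * a 0 else a l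

/-- Insert `1` behind the entry `j`. -/
def degen (j : ℕ) (a : ℕ → A) (l : ℕ) : A :=
  if l ≤ j then a l else if l = j + 1 then 1 else a (l - 1)

/-- Multiply the entry `k` by `c` from the right and the entry `k + 1` by `c` from the left. -/
def insertAt (k : ℕ) (c : A) (a : ℕ → A) (l : ℕ) : A :=
  if l = k then a l * c else if l = k + 1 then c * a l else a l

/-- Composition with the `i`-th face map from degree `n + 1` to degree `n`. -/
def coface (n i : ℕ) : ((ℕ → A) → ℂ) →ₗ[ℂ] ((ℕ → A) → ℂ) :=
  if i ≤ n then LinearMap.funLeft ℂ ℂ (face i) else LinearMap.funLeft ℂ ℂ (lastFace n)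

/-- Composition with the `j`-th degeneracy. -/
def codegen (j : ℕ) : ((ℕ → A) → ℂ) →ₗ[ℂ] ((ℕ → A) → ℂ) := LinearMap.funLeft ℂ ℂ (degen j)

/-- Insertion of the separability idempotent `e ⊗ e + (1 - e) ⊗ (1 - e)` behind the entry `k`. -/
def balance (e : A) (k : ℕ) : ((ℕ → A) → ℂ) →ₗ[ℂ] ((ℕ → A) → ℂ) :=
  LinearMap.funLeft ℂ ℂ (insertAt k e) + LinearMap.funLeft ℂ ℂ (insertAt k (1 - e))

/-- Insertion of the separability idempotent behind each of the entries `0, …, j - 1`. -/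
def balances (e : A) : ℕ → ((ℕ → A) → ℂ) →ₗ[ℂ] ((ℕ → A) → ℂ)
  | 0 => LinearMap.id
  | j + 1 => balances e j ∘ₗ balance e j

/-- The `j`-th component of the simplicial homotopy. -/
def homotopyTerm (e : A) (j : ℕ) : ((ℕ → A) → ℂ) →ₗ[ℂ] ((ℕ → A) → ℂ) :=
  codegen j ∘ₗ balances e (j + 1)

/-! ### Evaluation of the operators, and the coboundary as an alternating sum -/

theorem coface_apply {n i : ℕ} (hi : i ≤ n) (F : (ℕ → A) → ℂ) (a : ℕ → A) :
    coface n i F a = F (face i a) := by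
  simp [coface, hi, LinearMap.funLeft_apply]

theorem coface_last (n : ℕ) (F : (ℕ → A) → ℂ) (a : ℕ → A) :
    coface n (n + 1) F a = F (lastFace n a) := by
  simp [coface, LinearMap.funLeft_apply]

theorem codegen_apply (j : ℕ) (F : (ℕ → A) → ℂ) (a : ℕ → A) :
    codegen j F a = F (degen j a) := rfl

theorem balance_apply (e : A) (k : ℕ) (F : (ℕ → A) → ℂ) (a : ℕ → A) :
    balance e k F a = F (insertAt k e a) + F (insertAt k (1 - e) a) := rfl

theorem balances_succ (e : A) (j : ℕ) (F : (ℕ → A) → ℂ) :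
    balances e (j + 1) F = balances e j (balance e j F) := rfl

theorem homotopyTerm_apply (e : A) (j : ℕ) (F : (ℕ → A) → ℂ) :
    homotopyTerm e j F = codegen j (balances e (j + 1) F) := rfl

theorem seqEval_coboundary (n : ℕ) (f : Cochain A (DualBimodule A) n) :
    seqEval (n + 1) (coboundary A _ n f) =
      ∑ i ∈ Finset.range (n + 2), (-1 : ℂ) ^ i • coface n i (seqEval n f) := by
  ext a
  -- The two outer cofaces are the module actions: `(a · φ)(b) = φ(b a)` is face `0`, and `(φ ·
  -- a)(b) = φ(a b)` is the face that closes the cycle.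
  rw [Finset.sum_range_succ, Finset.sum_range_succ', Finset.sum_range]
  simp only [Pi.add_apply, Finset.sum_apply, Pi.smul_apply, coface_last]
  rw [Finset.sum_congr rfl fun i _ => by rw [coface_apply (by omega)], coface_apply (by omega)]
  simp only [seqEval_apply, coboundary, LinearMap.coe_mk, AddHom.coe_mk,
    add_apply, smul_apply, sum_apply, DualBimodule.add_apply, DualBimodule.smul_apply,
    dual_sum_apply, smul_eq_mul, pow_zero, one_mul]
  rw [add_comm (Finset.sum _ _)]
  refine congrArg₂ (· + ·) (congrArg₂ (· + ·) ?_ (Finset.sum_congr rfl fun i _ => ?_)) ?_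
  · simp [leftTerm_apply, face, Fin.tail_def]
  · rw [contractTerm_apply]
    congr 2
    · congr 1
      ext j
      simp only [Fin.contractNth, face, Fin.val_castSucc, Fin.val_succ]
      split_ifs <;> first | rfl | omega
  · simp [rightTerm_apply, lastFace, Fin.init_def]

/-! ### Operators that send cochains to cochains -/

theorem exists_seqEval_balance (e : A) {n k : ℕ} (f : Cochain A (DualBimodule A) n) :
    ∃ g, seqEval n g = balance e k (seqEval n f) := by
  have key : ∀ c : A, ∃ g, seqEval n g = LinearMap.funLeft ℂ ℂ (insertAt k c) (seqEval n f) := by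
    intro c
    obtain ⟨g, hg⟩ := exists_seqEval_map f fun l =>
      if l = k then (ContinuousLinearMap.mul ℂ A).flip c else
        if l = k + 1 then ContinuousLinearMap.mul ℂ A c else .id ℂ A
    refine ⟨g, hg.trans (funext fun a => congrArg (seqEval n f) (funext fun l => ?_))⟩
    simp only [insertAt]
    split_ifs <;> rfl
  obtain ⟨g, hg⟩ := key e
  obtain ⟨g', hg'⟩ := key (1 - e)
  exact ⟨g + g', by rw [map_add, hg, hg']; rfl⟩

theorem exists_seqEval_balances (e : A) {n : ℕ} (k : ℕ) (f : Cochain A (DualBimodule A) n) :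
    ∃ g, seqEval n g = balances e k (seqEval n f) := by
  induction k generalizing f with
  | zero => exact ⟨f, rfl⟩
  | succ k ih =>
    obtain ⟨g, hg⟩ := exists_seqEval_balance e (k := k) f
    obtain ⟨g', hg'⟩ := ih g
    exact ⟨g', by rw [hg', hg, balances_succ]⟩

theorem exists_seqEval_codegen {n j : ℕ} (hj : j ≤ n) (f : Cochain A (DualBimodule A) (n + 1)) :
    ∃ g, seqEval n g = codegen j (seqEval (n + 1) f) := by
  -- The inserted `1` is entry `j + 1` of the sequence, hence argument `j` of `f`.
  refine ⟨f.curryMid ⟨j, by omega⟩ 1, funext fun a => ?_⟩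
  rw [codegen_apply, seqEval_apply, seqEval_apply, ContinuousMultilinearMap.curryMid_apply]
  have h : degen j a 0 = a 0 := by simp [degen]
  rw [h]
  congr 2
  ext i
  refine Fin.succAboveCases ⟨j, by omega⟩ ?_ (fun i => ?_) i
  · simp [degen]
  · rw [Fin.insertNth_apply_succAbove]
    simp only [degen, Fin.succAbove, Fin.lt_def, Fin.val_castSucc]
    split_ifs <;> simp_all <;> grind

theorem exists_seqEval_homotopyTerm (e : A) {n j : ℕ} (hj : j ≤ n)
    (f : Cochain A (DualBimodule A) (n + 1)) :
    ∃ g, seqEval n g = homotopyTerm e j (seqEval (n + 1) f) := by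
  obtain ⟨g, hg⟩ := exists_seqEval_balances e (j + 1) f
  obtain ⟨g', hg'⟩ := exists_seqEval_codegen hj g
  exact ⟨g', by rw [hg', hg]; rfl⟩

/-! ### Identities between the operators -/

theorem balance_coface_of_lt (e : A) {n i k : ℕ} (hi : i ≤ n) (hk : k < i) (F : (ℕ → A) → ℂ) :
    balance e k (coface n i F) = coface n i (balance e k F) := by
  have key : ∀ (c : A) a, face i (insertAt k c a) = insertAt k c (face i a) := by
    intro c a
    ext l
    simp only [face, insertAt]
    split_ifs <;> first | omega | simp_all [mul_assoc]
  ext a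
  simp only [balance_apply, coface_apply hi, key]

theorem balance_coface_last (e : A) {n k : ℕ} (hk : k < n) (F : (ℕ → A) → ℂ) :
    balance e k (coface n (n + 1) F) = coface n (n + 1) (balance e k F) := by
  have key : ∀ (c : A) a, lastFace n (insertAt k c a) = insertAt k c (lastFace n a) := by
    intro c a
    ext l
    simp only [lastFace, insertAt]
    split_ifs <;> first | omega | simp_all [mul_assoc]
  ext a
  simp only [balance_apply, coface_last, key]

/-- The face moves every later entry down by one. For `k = i + 1` the right factor lands on the
merged entry `i`. -/
theorem balance_coface_of_gt (e : A) {n i k : ℕ} (hi : i ≤ n) (hk : i < k) (F : (ℕ → A) → ℂ) :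
    balance e k (coface n i F) = coface n i (balance e (k - 1) F) := by
  have key : ∀ (c : A) a, face i (insertAt k c a) = insertAt (k - 1) c (face i a) := by
    intro c a
    obtain ⟨k, rfl⟩ : ∃ k', k = k' + 1 := ⟨k - 1, by omega⟩
    ext l
    simp only [face, insertAt, Nat.add_sub_cancel]
    split_ifs <;> first | omega | rfl | (subst_vars; simp [mul_assoc])
  ext a
  simp only [balance_apply, coface_apply hi, key]

/-- Separability: `x e e y + x (1 - e) (1 - e) y = x y`. Adding the two values needs additivity of
`F` in the merged entry, so `F` must come from a cochain. -/
theorem balance_coface_self {e : A} (he : IsIdempotentElem e) {n i : ℕ} (hi : i ≤ n)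
    (f : Cochain A (DualBimodule A) n) :
    balance e i (coface n i (seqEval n f)) = coface n i (seqEval n f) := by
  ext a
  simp only [balance_apply, coface_apply hi]
  refine (seqEval_add f hi _ _ _ (fun l hl => ?_) (fun l hl => ?_) ?_).symm
  · simp only [face, insertAt]
    split_ifs <;> first | omega | rfl
  · simp only [face, insertAt]
    split_ifs <;> first | omega | rfl
  · have h₁ : e * (e * a (i + 1)) = e * a (i + 1) := by rw [← mul_assoc, he.eq]
    have h₂ : (1 - e) * ((1 - e) * a (i + 1)) = (1 - e) * a (i + 1) := by
      rw [← mul_assoc, he.one_sub.eq]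
    simp only [face, insertAt, lt_irrefl, if_true, if_false, Nat.succ_ne_self, mul_assoc, h₁, h₂]
    rw [← mul_add, ← add_mul, add_sub_cancel, one_mul]

theorem balances_coface_of_le (e : A) {n i j : ℕ} (hi : i ≤ n) (hj : j ≤ i)
    (F : (ℕ → A) → ℂ) : balances e j (coface n i F) = coface n i (balances e j F) := by
  induction j generalizing F with
  | zero => rfl
  | succ j ih =>
    rw [balances_succ, balance_coface_of_lt e hi hj, ih (by omega), balances_succ]

theorem balances_coface_last (e : A) {n j : ℕ} (hj : j ≤ n)
    (F : (ℕ → A) → ℂ) :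
    balances e j (coface n (n + 1) F) = coface n (n + 1) (balances e j F) := by
  induction j generalizing F with
  | zero => rfl
  | succ j ih =>
    rw [balances_succ, balance_coface_last e hj, ih (by omega), balances_succ]

/-- The insertion inside the merged pair is absorbed, and those behind it move down by one, so one
insertion is lost. -/
theorem balances_succ_coface {e : A} (he : IsIdempotentElem e) {n i j : ℕ} (hi : i ≤ n)
    (hj : i ≤ j) (f : Cochain A (DualBimodule A) n) :
    balances e (j + 1) (coface n i (seqEval n f)) = coface n i (balances e j (seqEval n f)) := by
  induction j, hj using Nat.le_induction generalizing f with
  | base => rw [balances_succ, balance_coface_self he hi, balances_coface_of_le e hi le_rfl]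
  | succ j hj ih =>
    -- The induction hypothesis speaks of cochains only, so the balanced function is first
    -- represented by one.
    obtain ⟨g, hg⟩ := exists_seqEval_balance e (k := j) f
    rw [balances_succ, balance_coface_of_gt e hi (by omega), Nat.add_sub_cancel, ← hg, ih, hg,
      balances_succ]

theorem codegen_coface_of_lt {n i j : ℕ} (hi : i ≤ n) (hj : i < j) (F : (ℕ → A) → ℂ) :
    codegen j (coface (n + 1) i F) = coface n i (codegen (j - 1) F) := by
  ext a
  simp only [codegen_apply, coface_apply hi, coface_apply (Nat.le_succ_of_le hi)]
  congr 1
  ext l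
  simp only [face, degen]
  split_ifs <;> first | omega | rfl | grind

theorem codegen_coface_self {n j : ℕ} (hj : j ≤ n) (F : (ℕ → A) → ℂ) :
    codegen j (coface n j F) = F := by
  ext a
  simp only [codegen_apply, coface_apply hj]
  congr 1
  ext l
  simp only [face, degen]
  split_ifs <;> first | omega | simp

theorem codegen_coface_succ {n j : ℕ} (hj : j + 1 ≤ n) (F : (ℕ → A) → ℂ) :
    codegen j (coface n (j + 1) F) = F := by
  ext a
  simp only [codegen_apply, coface_apply hj]
  congr 1
  ext l
  simp only [face, degen]
  split_ifs <;> first | omega | simp_all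

theorem codegen_coface_of_gt {n i j : ℕ} (hi : i + 1 ≤ n + 1) (hj : j < i) (F : (ℕ → A) → ℂ) :
    codegen j (coface (n + 1) (i + 1) F) = coface n i (codegen j F) := by
  ext a
  simp only [codegen_apply, coface_apply hi, coface_apply (Nat.le_of_succ_le_succ hi)]
  congr 1
  ext l
  simp only [face, degen]
  split_ifs <;> first | omega | rfl | grind

theorem codegen_coface_last {n j : ℕ} (hj : j ≤ n) (F : (ℕ → A) → ℂ) :
    codegen j (coface (n + 1) (n + 2) F) = coface n (n + 1) (codegen j F) := by
  ext a
  simp only [codegen_apply, coface_last]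
  congr 1
  ext l
  simp only [lastFace, degen]
  split_ifs <;> first | omega | rfl

end Simplicial

/-! ### The chain homotopy -/

/-- The alternating double sum that turns a simplicial homotopy into a chain homotopy. -/
theorem sum_simplicial_homotopy {M : Type*} [AddCommGroup M] [Module ℂ M] (m : ℕ)
    (t u : ℕ → ℕ → M) (q : ℕ → M)
    (hlt : ∀ j i, i < j → j ≤ m + 1 → t j i = u i (j - 1))
    (hself : ∀ j ≤ m + 1, t j j = q j) (hsucc : ∀ j ≤ m + 1, t j (j + 1) = q (j + 1))
    (hgt : ∀ j i, j + 1 < i → i ≤ m + 2 → t j i = u (i - 1) j) :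
    ∑ j ∈ Finset.range (m + 2), (-1 : ℂ) ^ j • ∑ i ∈ Finset.range (m + 3), (-1 : ℂ) ^ i • t j i =
      q 0 - q (m + 2) - ∑ i ∈ Finset.range (m + 2), (-1 : ℂ) ^ i •
        ∑ j ∈ Finset.range (m + 1), (-1 : ℂ) ^ j • u i j := by
  set w : ℕ → ℕ → M := fun i j => (-1 : ℂ) ^ (i + j) • u i j with hw
  have key : ∀ j ∈ Finset.range (m + 2), ∀ i ∈ Finset.range (m + 3),
      (-1 : ℂ) ^ j • (-1 : ℂ) ^ i • t j i =
        (if i = j then q j else 0) - (if i = j + 1 then q (j + 1) else 0)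
          - ((if i < j then w i (j - 1) else 0) + if j + 1 < i then w (i - 1) j else 0) := by
    -- The diagonals `i = j` and `i = j + 1` carry the signs `+` and `-`. Off them, one index of `u`
    -- drops by one, which flips the sign.
    intro j hj i hi
    rw [Finset.mem_range] at hj hi
    rw [smul_smul, ← pow_add]
    rcases lt_trichotomy i j with h | rfl | h
    · rw [if_neg h.ne, if_neg (by omega), if_pos h, if_neg (by omega), hlt j i h (by omega)]
      obtain ⟨j, rfl⟩ : ∃ j', j = j' + 1 := ⟨j - 1, by omega⟩
      simp only [hw, Nat.add_sub_cancel]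
      rw [show j + 1 + i = i + j + 1 by ring, pow_succ]
      module
    · rw [hself i (by omega), ← two_mul]
      simp
    · rcases eq_or_lt_of_le (Nat.succ_le_of_lt h) with rfl | h'
      · rw [hsucc j (by omega), Nat.succ_eq_add_one, ← add_assoc, ← two_mul, pow_succ]
        simp
      · rw [if_neg (by omega), if_neg (by omega), if_neg (by omega), if_pos h',
          hgt j i h' (by omega)]
        obtain ⟨i, rfl⟩ : ∃ i', i = i' + 1 := ⟨i - 1, by omega⟩
        simp only [hw, Nat.add_sub_cancel]
        rw [show j + (i + 1) = i + j + 1 by ring, pow_succ]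
        module
  -- The two diagonals telescope.
  have hdiag : ∑ j ∈ Finset.range (m + 2), ∑ i ∈ Finset.range (m + 3),
      ((if i = j then q j else 0) - if i = j + 1 then q (j + 1) else 0) = q 0 - q (m + 2) := by
    rw [← Finset.sum_range_sub']
    refine Finset.sum_congr rfl fun j hj => ?_
    rw [Finset.mem_range] at hj
    rw [Finset.sum_sub_distrib, Finset.sum_ite_eq', Finset.sum_ite_eq',
      if_pos (Finset.mem_range.2 (by omega)), if_pos (Finset.mem_range.2 (by omega))]
  -- The row `j = 0` is empty, and after the shift of `j` so is the column `i = m + 2`.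
  have hlow : ∑ j ∈ Finset.range (m + 2), ∑ i ∈ Finset.range (m + 3),
      (if i < j then w i (j - 1) else 0) =
      ∑ j ∈ Finset.range (m + 1), ∑ i ∈ Finset.range (m + 2), if i ≤ j then w i j else 0 := by
    rw [Finset.sum_range_succ']
    simp only [Nat.not_lt_zero, if_false, Finset.sum_const_zero, add_zero, Nat.add_sub_cancel]
    refine Finset.sum_congr rfl fun j hj => ?_
    rw [Finset.mem_range] at hj
    rw [Finset.sum_range_succ, if_neg (by omega), add_zero]
    exact Finset.sum_congr rfl fun i _ => by simp only [Nat.lt_succ_iff]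
  -- The row `j = m + 1` is empty, and so is the column `i = 0`. The ranges `i ≤ j` and `j < i` then
  -- tile the rectangle.
  have hhigh : ∑ j ∈ Finset.range (m + 2), ∑ i ∈ Finset.range (m + 3),
      (if j + 1 < i then w (i - 1) j else 0) =
      ∑ j ∈ Finset.range (m + 1), ∑ i ∈ Finset.range (m + 2), if j < i then w i j else 0 := by
    rw [Finset.sum_range_succ, Finset.sum_eq_zero (s := Finset.range (m + 3)), add_zero]
    · refine Finset.sum_congr rfl fun j _ => ?_
      rw [Finset.sum_range_succ', if_neg (by omega), add_zero]
      exact Finset.sum_congr rfl fun i _ => by simp only [add_lt_add_iff_right, Nat.add_sub_cancel]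
    · intro i hi
      rw [Finset.mem_range] at hi
      rw [if_neg (by omega)]
  simp only [Finset.smul_sum]
  rw [Finset.sum_congr rfl fun j hj => Finset.sum_congr rfl (key j hj)]
  simp only [Finset.sum_sub_distrib, Finset.sum_add_distrib] at hdiag ⊢
  rw [hdiag, hlow, hhigh, ← Finset.sum_add_distrib, Finset.sum_comm (s := Finset.range (m + 2))]
  congr 1
  refine Finset.sum_congr rfl fun j _ => ?_
  rw [← Finset.sum_add_distrib]
  refine Finset.sum_congr rfl fun i _ => ?_
  rw [smul_smul, ← pow_add]
  rcases le_or_gt i j with h | h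
  · rw [if_pos h, if_neg h.not_gt, add_zero]
  · rw [if_neg h.not_ge, if_pos h, zero_add]

noncomputable section Homotopy

variable {A : Type*} [NormedRing A] [NormedAlgebra ℂ A]

/-- A cocycle is cohomologous to its image under the last term of the simplicial homotopy. -/
theorem exists_coboundary_eq_sub_homotopyTerm {e : A} (he : IsIdempotentElem e) {m : ℕ}
    {f : Cochain A (DualBimodule A) (m + 1)} (hf : coboundary A _ (m + 1) f = 0) :
    ∃ g, seqEval (m + 1) (coboundary A _ m g) = seqEval (m + 1) f -
      homotopyTerm e (m + 1) (coface (m + 1) (m + 2) (seqEval (m + 1) f)) := by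
  -- The bound sits inside the existential, with `0` as default, so that `choose` gives a family
  -- over all of `ℕ`.
  have hg : ∀ j : ℕ, ∃ g, j ≤ m → seqEval m g = homotopyTerm e j (seqEval (m + 1) f) := by
    intro j
    by_cases hj : j ≤ m
    · obtain ⟨g, hg⟩ := exists_seqEval_homotopyTerm e hj f
      exact ⟨g, fun _ => hg⟩
    · exact ⟨0, fun h => absurd h hj⟩
  choose g hg using hg
  refine ⟨∑ j ∈ Finset.range (m + 1), (-1 : ℂ) ^ j • g j, ?_⟩
  set F := seqEval (m + 1) f with hF
  have h₀ : ∑ i ∈ Finset.range (m + 3), (-1 : ℂ) ^ i • coface (m + 1) i F = 0 := by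
    rw [hF, ← seqEval_coboundary, hf, map_zero]
  -- The telescoping sequence starts at `F` and gains one insertion per step; its last member, at `m
  -- + 2`, is the operator that closes the cycle.
  have hsum := sum_simplicial_homotopy m (fun j i => homotopyTerm e j (coface (m + 1) i F))
    (fun i j => coface m i (homotopyTerm e j F))
    (fun j => if j ≤ m + 1 then balances e j F else
      homotopyTerm e (m + 1) (coface (m + 1) (m + 2) F)) ?_ ?_ ?_ ?_
  · have h₁ (j : ℕ) : ∑ i ∈ Finset.range (m + 3),
        (-1 : ℂ) ^ i • homotopyTerm e j (coface (m + 1) i F) = 0 := by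
      rw [← map_zero (homotopyTerm e j), ← h₀, map_sum]
      simp only [map_smul]
    simp only [h₁, smul_zero, Finset.sum_const_zero] at hsum
    rw [if_pos (Nat.zero_le _), if_neg (by omega), eq_comm, sub_eq_zero] at hsum
    rw [seqEval_coboundary, map_sum]
    refine Eq.trans ?_ hsum.symm
    refine Finset.sum_congr rfl fun i _ => ?_
    rw [map_sum]
    congr 1
    refine Finset.sum_congr rfl fun j hj => ?_
    rw [map_smul, map_smul, hg j (Nat.lt_succ_iff.1 (Finset.mem_range.1 hj))]
  · intro j i hij hj
    simp only [homotopyTerm_apply]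
    obtain ⟨j, rfl⟩ : ∃ j', j = j' + 1 := ⟨j - 1, by omega⟩
    rw [hF, balances_succ_coface he (by omega) hij.le, codegen_coface_of_lt (by omega) hij,
      Nat.add_sub_cancel]
  · intro j hj
    rw [if_pos hj, homotopyTerm_apply, hF, balances_succ_coface he hj le_rfl,
      codegen_coface_self hj]
  · intro j hj
    rcases hj.lt_or_eq with h | rfl
    · rw [if_pos (Nat.succ_le_of_lt h), homotopyTerm_apply, balances_coface_of_le e h le_rfl,
        codegen_coface_succ h]
    -- For `j = m + 1` the coface closes the cycle, and the sequence was defined to end in this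
    -- term.
    · rw [if_neg (by omega)]
  · intro j i hij hi
    obtain ⟨i, rfl⟩ : ∃ i', i = i' + 1 := ⟨i - 1, by omega⟩
    simp only [homotopyTerm_apply, Nat.add_sub_cancel]
    rcases hi.lt_or_eq with h | h
    · rw [balances_coface_of_le e (by omega) (by omega), codegen_coface_of_gt (by omega) (by omega)]
    · obtain rfl : i = m + 1 := by omega
      rw [balances_coface_last e (by omega), codegen_coface_last (by omega)]

/-- In degree zero the cocycle condition says that the two cofaces agree, and the first one is
undone by the homotopy. -/
theorem eq_homotopyTerm_of_cocycle_zero {e : A} (he : IsIdempotentElem e)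
    {f : Cochain A (DualBimodule A) 0} (hf : coboundary A _ 0 f = 0) :
    homotopyTerm e 0 (coface 0 1 (seqEval 0 f)) = seqEval 0 f := by
  have h₀ := seqEval_coboundary 0 f
  simp only [hf, map_zero, Finset.sum_range_succ, Finset.sum_range_zero, zero_add, pow_zero,
    pow_one, one_smul, neg_smul] at h₀
  rw [eq_comm, add_neg_eq_zero] at h₀
  rw [← h₀, homotopyTerm_apply, balances_succ_coface he le_rfl le_rfl,
    codegen_coface_self le_rfl]
  rfl

/-! ### The last term of the homotopy for a triangular idempotent -/

/-- Multiply the entries `0, …, j` by `c` from the left. -/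
def leftMulUpTo (c : A) (j : ℕ) (a : ℕ → A) (l : ℕ) : A := if l ≤ j then c * a l else a l

theorem one_sub_mul_mul_self {e : A} (h : ∀ a, a * e = e * a * e) (a : A) :
    (1 - e) * a * e = 0 := by
  rw [sub_mul, sub_mul, one_mul, ← h, sub_self]

theorem one_sub_mul_mul_one_sub {e : A} (h : ∀ a, a * e = e * a * e) (a : A) :
    (1 - e) * a * (1 - e) = (1 - e) * a := by
  rw [mul_sub, mul_one, one_sub_mul_mul_self h, sub_zero]

/-- A factor `1 - e` on the left of entry `0` spreads forward: `(1 - e) b e = 0` forces the next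
inserted factor to be `1 - e` too. -/
theorem balances_eq_leftMulUpTo {e : A} (h : ∀ a, a * e = e * a * e) {n j : ℕ} (hj : j ≤ n)
    (K : (ℕ → A) → ℂ)
    (hK : ∀ b, K (leftMulUpTo (1 - e) 0 b) = K b) (hK₀ : ∀ b, ∀ k < n, b k = 0 → K b = 0)
    (b : ℕ → A) : balances e j K b = K (leftMulUpTo (1 - e) j b) := by
  induction j generalizing K with
  | zero => exact (hK b).symm
  | succ j ih =>
    rw [balances_succ, ih (by omega)]
    -- The summand for `e` has `(1 - e) * b j * e = 0` as entry `j`.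
    · rw [balance_apply, hK₀ _ j hj, zero_add]
      · congr 1
        ext l
        simp only [leftMulUpTo, insertAt]
        split_ifs <;> first | omega | rfl | exact one_sub_mul_mul_one_sub h _
      · simp only [leftMulUpTo, insertAt, le_refl, if_true, one_sub_mul_mul_self h]
    · intro b
      have key : ∀ c, insertAt j c (leftMulUpTo (1 - e) 0 b) =
          leftMulUpTo (1 - e) 0 (insertAt j c b) := by
        intro c
        ext l
        simp only [leftMulUpTo, insertAt]
        split_ifs <;> first | omega | simp [mul_assoc]
      simp only [balance_apply, key, hK]
    · intro b k hk hb
      have key : ∀ c, insertAt j c b k = 0 := by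
        intro c
        simp only [insertAt, hb]
        split_ifs <;> simp
      rw [balance_apply, hK₀ _ k hk (key _), hK₀ _ k hk (key _), add_zero]

/-- The mirror image: a factor `e` on the right of the last entry spreads backward, one entry for
each insertion, as the threshold `k` descends to `0`. -/
theorem balances_eq_mulRight {e : A} (h : ∀ a, a * e = e * a * e) {n k : ℕ} (hk : k ≤ n)
    (f : Cochain A (DualBimodule A) n) :
    balances e k (fun b => seqEval n f fun l => (if l = 0 then e * b (n + 1) * b l else b l) *
      if k ≤ l then e else 1) =
    fun b => seqEval n f fun l => (if l = 0 then e * b (n + 1) * b l else b l) * e := by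
  induction k with
  | zero => simp [balances]
  | succ k ih =>
    rw [balances_succ, ← ih (by omega)]
    congr 1
    ext b
    -- The summand for `1 - e` has `(1 - e) * b (k + 1) * e = 0` as a factor of entry `k + 1`.
    rw [balance_apply, add_comm, seqEval_eq_zero f hk (fun l => _ * _), zero_add]
    · refine seqEval_congr f fun l hl => ?_
      simp only [insertAt]
      split_ifs <;> first
        | omega
        | (simp [mul_assoc]; done)
        | simpa [mul_assoc] using (h (b l)).symm
    · simp [insertAt, one_sub_mul_mul_self h]

/-- If `(1 - e) a e = 0` for all `a`, the last term of the homotopy is the sum of the pullbacks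
under the homomorphisms `a ↦ a e` and `a ↦ (1 - e) a`. -/
theorem homotopyTerm_coface_last {e : A} (he : IsIdempotentElem e)
    (h : ∀ a, a * e = e * a * e) {n : ℕ} (f : Cochain A (DualBimodule A) n) :
    homotopyTerm e n (coface n (n + 1) (seqEval n f)) =
      fun a => seqEval n f (fun l => a l * e) + seqEval n f fun l => (1 - e) * a l := by
  -- The insertion behind entry `n` puts one factor on entry `n` and, around the cycle, the other on
  -- entry `0`. Only `l ≤ n` matters, so `n ≤ l` means `l = n`; the inequality is the form that
  -- `balances_eq_mulRight` needs.
  have hsplit : balance e n (coface n (n + 1) (seqEval n f)) =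
      (fun b => seqEval n f fun l => (if l = 0 then e * b (n + 1) * b l else b l) *
        if n ≤ l then e else 1) +
      fun b => seqEval n f fun l => (if l = 0 then (1 - e) * b (n + 1) * b l else b l) *
        if n ≤ l then 1 - e else 1 := by
    ext b
    rw [balance_apply, coface_last, coface_last]
    refine congrArg₂ (· + ·) (seqEval_congr f fun l hl => ?_) (seqEval_congr f fun l hl => ?_) <;>
    · simp only [lastFace, insertAt]
      split_ifs <;> first | contradiction | omega | (subst_vars; simp [mul_assoc])
  ext a
  rw [homotopyTerm_apply, codegen_apply, balances_succ, hsplit, map_add, Pi.add_apply,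
    balances_eq_mulRight h le_rfl f, balances_eq_leftMulUpTo h le_rfl]
  · refine congrArg₂ (· + ·) (seqEval_congr f fun l hl => ?_) (seqEval_congr f fun l hl => ?_)
    -- Entry `n + 1` is now the inserted `1`, so entry `0` is `e * 1 * a 0 * e = a 0 * e`.
    · simp only [degen]
      split_ifs <;> first | omega | rfl | skip
      simpa using (h _).symm
    · have h' := he.one_sub.eq
      simp only [leftMulUpTo, degen]
      split_ifs <;> first | omega | skip
      all_goals simp [one_sub_mul_mul_one_sub h, ← mul_assoc, h']
  · intro b
    refine seqEval_congr f fun l hl => ?_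
    simp only [leftMulUpTo]
    split_ifs <;> first | omega | rfl | skip
    all_goals subst_vars; simp [← mul_assoc, one_sub_mul_mul_one_sub h]
  · intro b k hk hb
    refine seqEval_eq_zero f hk.le _ ?_
    simp [hb]

end Homotopy

/-! ### Relative cochains -/

noncomputable section Relative

variable {A B : Type*} [NormedRing A] [NormedAlgebra ℂ A] [NormedRing B] [NormedAlgebra ℂ B]

/-- Read on the cycle, left linearity is balancing between the places `0` and `1`, on a par with the
inner conditions. -/
theorem seqEval_update_mul_right {S : NonUnitalSubalgebra ℂ A} {n k : ℕ} (hk : k < n)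
    {f : Cochain A (DualBimodule A) n} (hf : f ∈ relativeCochains (DualBimodule A) S n)
    {s : A} (hs : s ∈ S) (a : ℕ → A) :
    seqEval n f (Function.update a k (a k * s)) =
      seqEval n f (Function.update a (k + 1) (s * a (k + 1))) := by
  obtain ⟨n, rfl⟩ : ∃ n', n = n' + 1 := ⟨n - 1, by omega⟩
  obtain ⟨h₁, h₂, -⟩ := hf s hs fun i => a (i + 1)
  simp only [seqEval_apply, update_comp_val_succ hk]
  cases k with
  | zero =>
    refine Eq.symm (Eq.trans (congrArg (fun φ : DualBimodule A => φ _) h₁) ?_)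
    simp
  | succ k =>
    rw [update_comp_val_succ (by omega)]
    exact congrArg (fun φ : DualBimodule A => φ (a 0)) (h₂ ⟨k, by omega⟩)

/-- Right linearity balances across the closing of the cycle; in degree zero this is centrality. -/
theorem seqEval_update_last_mul_right {S : NonUnitalSubalgebra ℂ A} {n : ℕ}
    {f : Cochain A (DualBimodule A) n} (hf : f ∈ relativeCochains (DualBimodule A) S n)
    {s : A} (hs : s ∈ S) (a : ℕ → A) :
    seqEval n f (Function.update a n (a n * s)) =
      seqEval n f (Function.update a 0 (s * a 0)) := by
  cases n with
  | zero =>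
    have := congrArg (fun φ : DualBimodule A => φ (a 0)) (hf s hs fun i => a (i + 1))
    simpa [seqEval_apply] using this
  | succ n =>
    obtain ⟨-, -, h₃⟩ := hf s hs fun i => a (i + 1)
    simp only [seqEval_apply, update_comp_val_succ (Nat.lt_succ_self n)]
    refine Eq.trans (congrArg (fun φ : DualBimodule A => φ _) h₃) ?_
    simp

/-- Both copies of an inserted idempotent can be moved to entry `k + 1`, where they merge; then `e`
and `1 - e` add up to `1`. -/
theorem balance_eq_of_mem_relativeCochains {S : NonUnitalSubalgebra ℂ A} {e : A}
    (he : IsIdempotentElem e) (heS : e ∈ S) (heS' : 1 - e ∈ S) {n k : ℕ} (hk : k < n)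
    {f : Cochain A (DualBimodule A) n} (hf : f ∈ relativeCochains (DualBimodule A) S n) :
    balance e k (seqEval n f) = seqEval n f := by
  have key : ∀ c ∈ S, IsIdempotentElem c → ∀ a, seqEval n f (insertAt k c a) =
      seqEval n f (Function.update a (k + 1) (c * a (k + 1))) := by
    intro c hc hcc a
    have := seqEval_update_mul_right hk hf hc (Function.update a (k + 1) (c * a (k + 1)))
    simp only [Function.update_self, Function.update_idem, ← mul_assoc, hcc.eq] at this
    rw [← this]
    refine congrArg _ (funext fun l => ?_)
    simp only [insertAt, Function.update_apply]
    split_ifs <;> first | omega | (subst_vars; rfl)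
  ext a
  rw [balance_apply, key e heS he, key _ heS' he.one_sub]
  refine (seqEval_add f (k := k + 1) hk _ _ _ (fun l hl => ?_) (fun l hl => ?_) ?_).symm
  · rw [Function.update_of_ne hl]
  · rw [Function.update_of_ne hl]
  · rw [Function.update_self, Function.update_self, ← add_mul, add_sub_cancel, one_mul]

theorem balance_coface_last_of_mem_relativeCochains {S : NonUnitalSubalgebra ℂ A} {e : A}
    (he : IsIdempotentElem e) (heS : e ∈ S) (heS' : 1 - e ∈ S) {n : ℕ}
    {f : Cochain A (DualBimodule A) n} (hf : f ∈ relativeCochains (DualBimodule A) S n) :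
    balance e n (coface n (n + 1) (seqEval n f)) = coface n (n + 1) (seqEval n f) := by
  have key : ∀ c ∈ S, IsIdempotentElem c → ∀ a, seqEval n f (lastFace n (insertAt n c a)) =
      seqEval n f (Function.update a 0 (c * (a (n + 1) * a 0))) := by
    intro c hc hcc a
    -- Entry `0` already carries one `c`; the second comes around from entry `n` and merges with it.
    have := seqEval_update_last_mul_right hf hc
      (Function.update a 0 (c * (a (n + 1) * a 0)))
    simp only [Function.update_self, Function.update_idem, ← mul_assoc, hcc.eq] at this
    rw [← mul_assoc, ← this]
    refine seqEval_congr f fun l hl => ?_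
    simp only [lastFace, insertAt, Function.update_apply]
    split_ifs <;> first | contradiction | omega | (subst_vars; simp [mul_assoc])
  ext a
  rw [balance_apply, coface_last, coface_last, coface_last, key e heS he, key _ heS' he.one_sub]
  refine (seqEval_add f (k := 0) (Nat.zero_le n) _ _ _ (fun l hl => ?_) (fun l hl => ?_) ?_).symm
  · rw [Function.update_of_ne hl, lastFace, if_neg hl]
  · rw [Function.update_of_ne hl, lastFace, if_neg hl]
  · rw [Function.update_self, Function.update_self, ← add_mul, add_sub_cancel, one_mul, lastFace,
      if_pos rfl]

theorem homotopyTerm_coface_last_of_mem_relativeCochains {S : NonUnitalSubalgebra ℂ A} {e : A}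
    (he : IsIdempotentElem e) (heS : e ∈ S) (heS' : 1 - e ∈ S) {n : ℕ}
    {f : Cochain A (DualBimodule A) n} (hf : f ∈ relativeCochains (DualBimodule A) S n) :
    homotopyTerm e n (coface n (n + 1) (seqEval n f)) = seqEval n f := by
  have hb : ∀ j ≤ n, balances e j (seqEval n f) = seqEval n f := by
    intro j hj
    induction j with
    | zero => rfl
    | succ j ih =>
      rw [balances_succ, balance_eq_of_mem_relativeCochains he heS heS' hj hf, ih (by omega)]
  rw [homotopyTerm_apply, balances_succ, balance_coface_last_of_mem_relativeCochains he heS heS' hf,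
    balances_coface_last e le_rfl, hb n le_rfl]
  -- No insertion is left: entry `0` is multiplied by the inserted `1`, and the other entries up to
  -- `n` are untouched.
  ext a
  rw [codegen_apply, coface_last]
  refine seqEval_congr f fun l hl => ?_
  simp only [lastFace, degen]
  split_ifs <;> first | omega | simp_all

/-- Pullbacks under a homomorphism that maps `S` to the scalars are `S`-relative. -/
theorem pullback_mem_relativeCochains {S : NonUnitalSubalgebra ℂ A} (π : A →L[ℂ] B)
    (hπ : ∀ x y, π (x * y) = π x * π y) (hS : ∀ s ∈ S, ∃ c : ℂ, π s = c • 1) (n : ℕ)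
    (f : Cochain B (DualBimodule B) n) :
    pullback π n f ∈ relativeCochains (DualBimodule A) S n := by
  cases n with
  | zero =>
    intro s hs a
    obtain ⟨c, hc⟩ := hS s hs
    ext b
    simp [hπ, hc]
  | succ n =>
    intro s hs a
    obtain ⟨c, hc⟩ := hS s hs
    have key : ∀ k x, (fun i => π (Function.update a k x i)) =
        Function.update (fun i => π (a i)) k (π x) := by
      intro k x
      ext i
      exact Function.apply_update (fun _ => π) a k x i
    -- Multiplication by `s` from either side becomes the same scalar, which multilinearity pulls
    -- out of any argument.
    have hl : ∀ x, π (s * x) = c • π x := fun x => by rw [hπ, hc, smul_one_mul]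
    have hr : ∀ x, π (x * s) = c • π x := fun x => by rw [hπ, hc, mul_smul_one]
    refine ⟨?_, fun i => ?_, ?_⟩
    · ext b
      rw [DualBimodule.left_smul_apply, pullback_apply, pullback_apply, key, hl, hr,
        ContinuousMultilinearMap.map_update_smul, Function.update_eq_self, map_smul]
      rfl
    · ext b
      rw [pullback_apply, pullback_apply, key, key, hl, hr,
        ContinuousMultilinearMap.map_update_smul, ContinuousMultilinearMap.map_update_smul,
        Function.update_eq_self, Function.update_eq_self]
    · ext b
      rw [DualBimodule.right_smul_apply, pullback_apply, pullback_apply, key, MulOpposite.unop_op,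
        hl, hr, ContinuousMultilinearMap.map_update_smul, Function.update_eq_self, map_smul]
      rfl

/-! ### Continuity of pullbacks and of the maps in cohomology -/

theorem continuous_pullback (π : A →L[ℂ] B) (n : ℕ) : Continuous (pullback π n) :=
  (ContinuousLinearMap.compContinuousMultilinearMapL ℂ (fun _ : Fin n => A) (DualBimodule B)
    (DualBimodule A) (DualBimodule.adjoint π)).continuous.comp
    (ContinuousMultilinearMap.compContinuousLinearMapL fun _ : Fin n => π).continuous

theorem continuous_inducedMap (π : A →L[ℂ] B) (hπ : ∀ x y, π (x * y) = π x * π y) (n : ℕ) :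
    Continuous (inducedMap π hπ n) := by
  refine (Submodule.isQuotientMap_mkQ _).continuous_iff.2 ?_
  refine (Submodule.isQuotientMap_mkQ _).continuous.comp ?_
  exact ((continuous_pullback π n).comp continuous_subtype_val).subtype_mk _

end Relative

/-! ### The diagonal corners of the triangular algebra -/

namespace Triangular

noncomputable section Corners

variable {A₁ A₂ Y : Type*} [NormedRing A₁] [NormedAlgebra ℂ A₁]
variable [NormedRing A₂] [NormedAlgebra ℂ A₂]
variable [NormedAddCommGroup Y] [NormedSpace ℂ Y] [Module A₁ Y] [Module A₂ᵐᵒᵖ Y]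
variable [SMulCommClass A₁ A₂ᵐᵒᵖ Y] [IsScalarTower ℂ A₁ Y] [IsScalarTower ℂ A₂ᵐᵒᵖ Y]
variable [ContinuousSMul A₁ Y] [ContinuousSMul A₂ᵐᵒᵖ Y]

variable (A₁ A₂ Y) in
/-- The idempotent `e₁₁`. -/
def idem : Triangular A₁ A₂ Y := ⟨1, 0, 0⟩

theorem isIdempotentElem_idem : IsIdempotentElem (idem A₁ A₂ Y) := by
  ext <;> simp [idem]

theorem one_sub_idem : 1 - idem A₁ A₂ Y = ⟨0, 0, 1⟩ := by
  rw [sub_eq_add_neg]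
  ext <;> simp [idem]

theorem mul_idem (u : Triangular A₁ A₂ Y) :
    u * idem A₁ A₂ Y = incl₁ A₁ A₂ Y (proj₁ A₁ A₂ Y u) := by
  ext <;> simp [idem]

theorem one_sub_idem_mul (u : Triangular A₁ A₂ Y) :
    (1 - idem A₁ A₂ Y) * u = incl₂ A₁ A₂ Y (proj₂ A₁ A₂ Y u) := by
  rw [one_sub_idem]
  ext <;> simp

/-- This is the vanishing of the lower left corner. -/
theorem mul_idem_eq (u : Triangular A₁ A₂ Y) :
    u * idem A₁ A₂ Y = idem A₁ A₂ Y * u * idem A₁ A₂ Y := by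
  ext <;> simp [idem]

theorem idem_mem : idem A₁ A₂ Y ∈ diagonalSubalgebra A₁ A₂ Y :=
  NonUnitalSubalgebra.le_topologicalClosure _
    (NonUnitalAlgebra.subset_adjoin ℂ (Set.mem_insert _ _))

theorem one_sub_idem_mem : 1 - idem A₁ A₂ Y ∈ diagonalSubalgebra A₁ A₂ Y := by
  rw [one_sub_idem]
  exact NonUnitalSubalgebra.le_topologicalClosure _
    (NonUnitalAlgebra.subset_adjoin ℂ (Set.mem_insert_of_mem _ rfl))

/-- A bounded homomorphism that maps `e₁₁` and `e₂₂` to scalars maps the subalgebra that they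
generate to scalars. -/
theorem exists_eq_smul_one_of_mem {B : Type*} [NormedRing B] [NormedAlgebra ℂ B]
    (π : Triangular A₁ A₂ Y →L[ℂ] B) (hπ : ∀ x y, π (x * y) = π x * π y)
    (h₁ : ∃ c : ℂ, π ⟨1, 0, 0⟩ = c • 1) (h₂ : ∃ c : ℂ, π ⟨0, 0, 1⟩ = c • 1)
    {s : Triangular A₁ A₂ Y} (hs : s ∈ diagonalSubalgebra A₁ A₂ Y) : ∃ c : ℂ, π s = c • 1 := by
  -- The scalars form a finite-dimensional, hence closed, subspace, so the property passes to the
  -- closure.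
  have hclosed : IsClosed {s | π s ∈ Submodule.span ℂ {(1 : B)}} :=
    (Submodule.closed_of_finiteDimensional _).preimage π.continuous
  have hsub : ((NonUnitalAlgebra.adjoin ℂ {(⟨1, 0, 0⟩ : Triangular A₁ A₂ Y), ⟨0, 0, 1⟩} :
      NonUnitalSubalgebra ℂ (Triangular A₁ A₂ Y)) : Set (Triangular A₁ A₂ Y)) ⊆
      {s | π s ∈ Submodule.span ℂ {(1 : B)}} := by
    intro x hx
    simp only [Set.mem_ofPred_eq, Submodule.mem_span_singleton, eq_comm (b := π _)]
    induction hx using NonUnitalAlgebra.adjoin_induction with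
    | mem x hx =>
      rcases hx with rfl | rfl
      exacts [h₁, h₂]
    | add x y _ _ hx hy =>
      obtain ⟨c, hc⟩ := hx
      obtain ⟨d, hd⟩ := hy
      exact ⟨c + d, by rw [map_add, hc, hd, add_smul]⟩
    | zero => exact ⟨0, by simp⟩
    | mul x y _ _ hx hy =>
      obtain ⟨c, hc⟩ := hx
      obtain ⟨d, hd⟩ := hy
      exact ⟨c * d, by rw [hπ, hc, hd, smul_mul_smul_comm, one_mul]⟩
    | smul r x _ hx =>
      obtain ⟨c, hc⟩ := hx
      exact ⟨r * c, by rw [map_smul, hc, smul_smul]⟩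
  obtain ⟨c, hc⟩ := Submodule.mem_span_singleton.1 (closure_minimal hsub hclosed hs)
  exact ⟨c, hc.symm⟩

/-- The corner inclusions need not be unital; multiplicativity alone lets restriction to a corner
act on cohomology. -/
theorem incl₁_mul (a b : A₁) : incl₁ A₁ A₂ Y (a * b) = incl₁ A₁ A₂ Y a * incl₁ A₁ A₂ Y b := by
  ext <;> simp

theorem incl₂_mul (a b : A₂) : incl₂ A₁ A₂ Y (a * b) = incl₂ A₁ A₂ Y a * incl₂ A₁ A₂ Y b := by
  ext <;> simp

/-- The diagonal part of a cochain. -/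
theorem seqEval_diagonal {n : ℕ}
    (f : Cochain (Triangular A₁ A₂ Y) (DualBimodule (Triangular A₁ A₂ Y)) n) :
    seqEval n (pullback (proj₁ A₁ A₂ Y) n (pullback (incl₁ A₁ A₂ Y) n f) +
        pullback (proj₂ A₁ A₂ Y) n (pullback (incl₂ A₁ A₂ Y) n f)) =
      homotopyTerm (idem A₁ A₂ Y) n (coface n (n + 1) (seqEval n f)) := by
  rw [homotopyTerm_coface_last isIdempotentElem_idem mul_idem_eq]
  simp only [mul_idem, one_sub_idem_mul]
  rfl

theorem diagonal_eq_of_mem_relativeCochains {n : ℕ}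
    {f : Cochain (Triangular A₁ A₂ Y) (DualBimodule (Triangular A₁ A₂ Y)) n}
    (hf : f ∈ relativeCochains _ (diagonalSubalgebra A₁ A₂ Y) n) :
    pullback (proj₁ A₁ A₂ Y) n (pullback (incl₁ A₁ A₂ Y) n f) +
      pullback (proj₂ A₁ A₂ Y) n (pullback (incl₂ A₁ A₂ Y) n f) = f :=
  seqEval_injective n ((seqEval_diagonal f).trans
    (homotopyTerm_coface_last_of_mem_relativeCochains isIdempotentElem_idem idem_mem
      one_sub_idem_mem hf))

/-- A cocycle is cohomologous to its diagonal part. -/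
theorem sub_diagonal_mem_coboundaries {n : ℕ}
    {f : Cochain (Triangular A₁ A₂ Y) (DualBimodule (Triangular A₁ A₂ Y)) n}
    (hf : coboundary _ _ n f = 0) :
    f - (pullback (proj₁ A₁ A₂ Y) n (pullback (incl₁ A₁ A₂ Y) n f) +
      pullback (proj₂ A₁ A₂ Y) n (pullback (incl₂ A₁ A₂ Y) n f)) ∈ coboundaries _ _ n := by
  cases n with
  | zero =>
    -- There are no coboundaries in degree zero, so equality itself is needed.
    refine (Submodule.mem_bot ℂ).2 (sub_eq_zero.2 (seqEval_injective 0 ?_))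
    rw [seqEval_diagonal, eq_homotopyTerm_of_cocycle_zero isIdempotentElem_idem hf]
  | succ m =>
    obtain ⟨g, hg⟩ := exists_coboundary_eq_sub_homotopyTerm isIdempotentElem_idem hf
    exact ⟨g, seqEval_injective (m + 1) (by rw [hg, map_sub, seqEval_diagonal])⟩

theorem pullback_proj₁_mem (n : ℕ) (f : Cochain A₁ (DualBimodule A₁) n) :
    pullback (proj₁ A₁ A₂ Y) n f ∈ relativeCochains _ (diagonalSubalgebra A₁ A₂ Y) n :=
  pullback_mem_relativeCochains _ proj₁_mul (fun _ hs => exists_eq_smul_one_of_mem _ proj₁_mul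
    ⟨1, by simp⟩ ⟨0, by simp⟩ hs) n f

theorem pullback_proj₂_mem (n : ℕ) (f : Cochain A₂ (DualBimodule A₂) n) :
    pullback (proj₂ A₁ A₂ Y) n f ∈ relativeCochains _ (diagonalSubalgebra A₁ A₂ Y) n :=
  pullback_mem_relativeCochains _ proj₂_mul (fun _ hs => exists_eq_smul_one_of_mem _ proj₂_mul
    ⟨0, by simp⟩ ⟨1, by simp⟩ hs) n f

/-- The other summand vanishes even in degree zero, because the argument of its functional is `0`.
-/
theorem pullback_incl₁_add (n : ℕ) (f₁ : Cochain A₁ (DualBimodule A₁) n)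
    (f₂ : Cochain A₂ (DualBimodule A₂) n) :
    pullback (incl₁ A₁ A₂ Y) n (pullback (proj₁ A₁ A₂ Y) n f₁ + pullback (proj₂ A₁ A₂ Y) n f₂) =
      f₁ := by
  ext a b
  simp

theorem pullback_incl₂_add (n : ℕ) (f₁ : Cochain A₁ (DualBimodule A₁) n)
    (f₂ : Cochain A₂ (DualBimodule A₂) n) :
    pullback (incl₂ A₁ A₂ Y) n (pullback (proj₁ A₁ A₂ Y) n f₁ + pullback (proj₂ A₁ A₂ Y) n f₂) =
      f₂ := by
  ext a b
  simp

variable (A₁ A₂ Y)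

/-- Relative cochains of the triangular algebra are pairs of cochains of the diagonal corners. -/
def relativeCochainsEquiv (n : ℕ) :
    relativeCochains (DualBimodule (Triangular A₁ A₂ Y)) (diagonalSubalgebra A₁ A₂ Y) n ≃L[ℂ]
      Cochain A₁ (DualBimodule A₁) n × Cochain A₂ (DualBimodule A₂) n where
  toLinearMap := ((pullback (incl₁ A₁ A₂ Y) n).prod (pullback (incl₂ A₁ A₂ Y) n)).comp
    (Submodule.subtype _)
  invFun f := ⟨pullback (proj₁ A₁ A₂ Y) n f.1 + pullback (proj₂ A₁ A₂ Y) n f.2,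
    Submodule.add_mem _ (pullback_proj₁_mem n f.1) (pullback_proj₂_mem n f.2)⟩
  left_inv ρ := Subtype.ext (diagonal_eq_of_mem_relativeCochains ρ.2)
  right_inv f := Prod.ext (pullback_incl₁_add n f.1 f.2) (pullback_incl₂_add n f.1 f.2)
  continuous_toFun := ((continuous_pullback _ n).prodMk (continuous_pullback _ n)).comp
    continuous_subtype_val
  continuous_invFun := (((continuous_pullback _ n).comp continuous_fst).add
    ((continuous_pullback _ n).comp continuous_snd)).subtype_mk _

/-- The cohomology of the triangular algebra is the sum of those of the diagonal corners. -/
def cohomologyEquiv (n : ℕ) :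
    Cohomology (Triangular A₁ A₂ Y) (DualBimodule (Triangular A₁ A₂ Y)) n ≃L[ℂ]
      Cohomology A₁ (DualBimodule A₁) n × Cohomology A₂ (DualBimodule A₂) n where
  toLinearMap := (inducedMap (incl₁ A₁ A₂ Y) incl₁_mul n).prod
    (inducedMap (incl₂ A₁ A₂ Y) incl₂_mul n)
  invFun c :=
    inducedMap (proj₁ A₁ A₂ Y) proj₁_mul n c.1 + inducedMap (proj₂ A₁ A₂ Y) proj₂_mul n c.2
  left_inv c := by
    obtain ⟨f, rfl⟩ := Submodule.Quotient.mk_surjective _ c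
    refine Eq.symm ((Submodule.Quotient.eq _).2 ?_)
    exact sub_diagonal_mem_coboundaries f.2
  right_inv c := by
    obtain ⟨c₁, c₂⟩ := c
    obtain ⟨f₁, rfl⟩ := Submodule.Quotient.mk_surjective _ c₁
    obtain ⟨f₂, rfl⟩ := Submodule.Quotient.mk_surjective _ c₂
    -- This composite is the identity already on cocycles; only the other one needs coboundaries.
    exact Prod.ext
      (congrArg Submodule.Quotient.mk (Subtype.ext (pullback_incl₁_add n f₁.1 f₂.1)))
      (congrArg Submodule.Quotient.mk (Subtype.ext (pullback_incl₂_add n f₁.1 f₂.1)))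
  continuous_toFun := (continuous_inducedMap _ _ n).prodMk (continuous_inducedMap _ _ n)
  continuous_invFun := ((continuous_inducedMap (proj₁ A₁ A₂ Y) proj₁_mul n).comp continuous_fst).add
    ((continuous_inducedMap (proj₂ A₁ A₂ Y) proj₂_mul n).comp continuous_snd)

end Corners

end Triangular

end BanachCohomology

open BanachCohomology in
/-- `A₁`, `A₂` are unital Banach algebras and `Y` is a unital Banach `A₁`-`A₂`-bimodule (right
action: `MulOpposite.op a₂ • y`). -/
theorem proposition1p10
    (A₁ A₂ Y : Type*)
    [NormedRing A₁] [NormedAlgebra ℂ A₁] [CompleteSpace A₁]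
    [NormedRing A₂] [NormedAlgebra ℂ A₂] [CompleteSpace A₂]
    [NormedAddCommGroup Y] [NormedSpace ℂ Y] [CompleteSpace Y]
    [Module A₁ Y] [Module A₂ᵐᵒᵖ Y] [SMulCommClass A₁ A₂ᵐᵒᵖ Y]
    [IsScalarTower ℂ A₁ Y] [IsScalarTower ℂ A₂ᵐᵒᵖ Y]
    [ContinuousSMul A₁ Y] [ContinuousSMul A₂ᵐᵒᵖ Y] (n : ℕ) :
    (∃ Φ : relativeCochains (DualBimodule (Triangular A₁ A₂ Y))
          (Triangular.diagonalSubalgebra A₁ A₂ Y) n ≃L[ℂ]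
        Cochain A₁ (DualBimodule A₁) n × Cochain A₂ (DualBimodule A₂) n,
      (∀ ρ, Φ ρ = (pullback (Triangular.incl₁ A₁ A₂ Y) n ρ,
          pullback (Triangular.incl₂ A₁ A₂ Y) n ρ)) ∧
      (∀ f₁ f₂, (Φ.symm (f₁, f₂) : Cochain (Triangular A₁ A₂ Y) _ n) =
          pullback (Triangular.proj₁ A₁ A₂ Y) n f₁ + pullback (Triangular.proj₂ A₁ A₂ Y) n f₂)) ∧
    (∃ Ψ : Cohomology (Triangular A₁ A₂ Y) (DualBimodule (Triangular A₁ A₂ Y)) n ≃L[ℂ]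
        Cohomology A₁ (DualBimodule A₁) n × Cohomology A₂ (DualBimodule A₂) n,
      ∀ c₁ c₂, Ψ.symm (c₁, c₂) =
        inducedMap (Triangular.proj₁ A₁ A₂ Y) Triangular.proj₁_mul n c₁ +
        inducedMap (Triangular.proj₂ A₁ A₂ Y) Triangular.proj₂_mul n c₂) := by
  exact ⟨⟨Triangular.relativeCochainsEquiv A₁ A₂ Y n, fun _ => rfl, fun _ _ => rfl⟩,
    Triangular.cohomologyEquiv A₁ A₂ Y n, fun _ _ => rfl⟩
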